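/- **Theorem ($\mathrm{HA}_{\longrightarrow}$ is a conservative extension of $\mathrm{HA}$).** Let $\mathrm{HA}$ be Heyting arithmetic: the one-sorted intuitionistic theory in the language $0, S, +, \times, =$ whose axioms are the axioms of equality (reflexivity, symmetry, transitivity, compatibility with $S$, $+$, $\times$), $\forall x\forall y\,(S(x)=S(y)\Rightarrow x=y)$, $\forall x\,\neg(0=S(x))$, the induction scheme $(0/x)P\Rightarrow\forall y\,((y/x)P\Rightarrow(S(y)/x)P)\Rightarrow\forall n\,(n/x)P$ for every proposition $P$ of this language (universally closed over the parameters of $P$), $\forall y\,(0+y=y)$, $\forall x\forall y\,(S(x)+y=S(x+y))$, $\forall y\,(0\times y=0)$ and $\forall x\forall y\,(S(x)\times y=x\times y+y)$. Let $\mathrm{HA}_{\longrightarrow}$ be the following theory in intuitionistic natural deduction modulo. It has two sorts, $\iota$ (numbers) and $\kappa$ (classes). Its symbols are $0:\iota$; $S,\mathit{Pred}$ of rank $\langle\iota,\iota\rangle$; $+,\times$ of rank $\langle\iota,\iota,\iota\rangle$; predicate symbols $=$ of rank $\langle\iota,\iota\rangle$, $\mathit{Null}$ and $N$ of rank $\langle\iota\rangle$,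 $\in$ of rank $\langle\iota,\kappa\rangle$; and, for every proposition $P$ in the one-sorted language $0,S,\mathit{Pred},+,\times,=,\mathit{Null},N$ whose free variables are among $x,y_1,\dots,y_n$, a function symbol $f_{x,y_1,\dots,y_n,P}$ of rank $\langle\iota,\dots,\iota,\kappa\rangle$ with $n$ arguments. It has no axioms. Its congruence $\equiv$ on propositions is the one generated by the rewrite rules $$y=z\longrightarrow\forall p\,(y\in p\Rightarrow z\in p),$$ $$N(n)\longrightarrow\forall p\,\bigl(0\in p\Rightarrow\forall y\,(N(y)\Rightarrow y\in p\Rightarrow S(y)\in p)\Rightarrow n\in p\bigr),$$ $$x\in f_{x,y_1,\dots,y_n,P}(y_1,\dots,y_n)\longrightarrow P,$$ $$\mathit{Pred}(0)\longrightarrow 0,\quad \mathit{Pred}(S(x))\longrightarrow x,\quad \mathit{Null}(0)\longrightarrow\top,\quad \mathit{Null}(S(x))\longrightarrow\bot,$$ $$0+y\longrightarrow y,\quad S(x)+y\longrightarrow S(x+y),\quad 0\times y\longrightarrow 0,\quad S(x)\times y\longrightarrow x\times y+y,$$ and each rule of natural deduction is applied up to $\equiv$ (for instance, from $C$ and $A$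 infer $B$ whenever $C\equiv(A\Rightarrow B)$). For a proposition $A$ in the language of $\mathrm{HA}$ let $|A|$ be its relativization to $N$: $|\cdot|$ leaves atomic propositions unchanged, commutes with $\top,\bot,\wedge,\vee,\Rightarrow$, and $|\forall x\,A|=\forall x\,(N(x)\Rightarrow|A|)$, $|\exists x\,A|=\exists x\,(N(x)\wedge|A|)$. Then, for every closed proposition $A$ in the language of $\mathrm{HA}$, $|A|$ is provable in $\mathrm{HA}_{\longrightarrow}$ if and only if $A$ is provable in $\mathrm{HA}$. -/

import Mathlib

/-! ## Many-sorted intuitionistic predicate logic and natural deduction modulo -/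

namespace DedMod

/-- A many-sorted first-order language: sorts, function symbols `f` of rank
`⟨fnDom f 0, …, fnDom f (fnAr f - 1), fnCod f⟩` and predicate symbols `r` of rank
`⟨relDom r 0, …, relDom r (relAr r - 1)⟩`. -/
structure Signature where
  Srt : Type
  [decSrt : DecidableEq Srt]
  Fn : Type
  fnAr : Fn → ℕ
  fnDom : (f : Fn) → Fin (fnAr f) → Srt
  fnCod : Fn → Srt
  Rel : Type
  relAr : Rel → ℕ
  relDom : (r : Rel) → Fin (relAr r) → Srt

instance (L : Signature) : DecidableEq L.Srt := L.decSrt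

/-- Well-sorted terms. Every sort has its own variables, numbered by de Bruijn indices. -/
inductive Term (L : Signature) : L.Srt → Type
  | var (s : L.Srt) (n : ℕ) : Term L s
  | func (f : L.Fn) (ts : (i : Fin (L.fnAr f)) → Term L (L.fnDom f i)) : Term L (L.fnCod f)

/-- Propositions. `all s A` and `ex s A` bind the variable of sort `s` with index `0` in `A`;
in `A` the indices of the other variables of sort `s` are raised by one, while the indices of
the variables of the other sorts are unchanged. -/
inductive Formula (L : Signature) : Type
  | rel (r : L.Rel) (ts : (i : Fin (L.relAr r)) → Term L (L.relDom r i)) : Formula L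
  | top : Formula L
  | bot : Formula L
  | and (A B : Formula L) : Formula L
  | or (A B : Formula L) : Formula L
  | imp (A B : Formula L) : Formula L
  | all (s : L.Srt) (A : Formula L) : Formula L
  | ex (s : L.Srt) (A : Formula L) : Formula L

/-- A simultaneous substitution. -/
abbrev Subst (L : Signature) : Type := (s : L.Srt) → ℕ → Term L s

variable {L : Signature}

def Term.subst (σ : Subst L) : {s : L.Srt} → Term L s → Term L s
  | _, .var s n => σ s n
  | _, .func f ts => .func f (fun i => (ts i).subst σ)

/-- Raise by one the index of every variable of sort `s`. -/
def Subst.shift (s : L.Srt) : Subst L :=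
  fun s' n => if s' = s then .var s' (n + 1) else .var s' n

/-- The substitution `σ` carried under a binder of sort `s`. -/
def Subst.up (s : L.Srt) (σ : Subst L) : Subst L :=
  fun s' n =>
    if s' = s then
      match n with
      | 0 => .var s' 0
      | m + 1 => (σ s' m).subst (Subst.shift s)
    else (σ s' n).subst (Subst.shift s)

/-- Replace the variable of sort `s` with index `0` by `t` and lower the other indices of
sort `s`. -/
def Subst.inst {s : L.Srt} (t : Term L s) : Subst L :=
  fun s' n =>
    if h : s' = s then
      match n with
      | 0 => h ▸ t
      | m + 1 => .var s' m
    else .var s' n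

namespace Formula

/-- Capture-avoiding simultaneous substitution. -/
def subst : Subst L → Formula L → Formula L
  | σ, .rel r ts => .rel r (fun i => (ts i).subst σ)
  | _, .top => .top
  | _, .bot => .bot
  | σ, .and A B => .and (A.subst σ) (B.subst σ)
  | σ, .or A B => .or (A.subst σ) (B.subst σ)
  | σ, .imp A B => .imp (A.subst σ) (B.subst σ)
  | σ, .all s A => .all s (A.subst (Subst.up s σ))
  | σ, .ex s A => .ex s (A.subst (Subst.up s σ))

/-- `A` seen in a context with a new variable of sort `s`, with index `0`, not free in it. -/
def shift (s : L.Srt) (A : Formula L) : Formula L := A.subst (Subst.shift s)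

/-- `(t/x)A`, where `x` is the variable with index `0` of the sort of `t`. -/
def inst {s : L.Srt} (t : Term L s) (A : Formula L) : Formula L := A.subst (Subst.inst t)

/-- Negation. -/
def neg (A : Formula L) : Formula L := .imp A .bot

/-- `n` successive universal quantifiers of sort `s`. -/
def allN (s : L.Srt) : ℕ → Formula L → Formula L
  | 0, A => A
  | n + 1, A => .all s (allN s n A)

end Formula

/-- All the variables of sort `s` in the term have an index below `k s`. -/
def Term.Bounded (k : L.Srt → ℕ) : {s : L.Srt} → Term L s → Prop
  | _, .var s n => n < k s
  | _, .func _ ts => ∀ i, (ts i).Bounded k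

/-- All the free variables of sort `s` in the proposition have an index below `k s`. -/
def Formula.Bounded : (L.Srt → ℕ) → Formula L → Prop
  | k, .rel _ ts => ∀ i, (ts i).Bounded k
  | _, .top => True
  | _, .bot => True
  | k, .and A B => A.Bounded k ∧ B.Bounded k
  | k, .or A B => A.Bounded k ∧ B.Bounded k
  | k, .imp A B => A.Bounded k ∧ B.Bounded k
  | k, .all s A => A.Bounded (Function.update k s (k s + 1))
  | k, .ex s A => A.Bounded (Function.update k s (k s + 1))

/-- A closed proposition: one without free variables. -/
def Formula.Closed (A : Formula L) : Prop := A.Bounded (fun _ => 0)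

/-- Intuitionistic natural deduction modulo the relation `E` on propositions: `Proves E Γ B`
says that the sequent `Γ ⊢ B` is provable modulo `E`. A fresh variable is introduced by
shifting the hypotheses. With `E` equality, this is natural deduction in predicate logic. -/
inductive Proves (E : Formula L → Formula L → Prop) : Set (Formula L) → Formula L → Prop
  | ax {Γ : Set (Formula L)} {A B : Formula L} (hA : A ∈ Γ) (h : E A B) : Proves E Γ B
  | impI {Γ : Set (Formula L)} {A B C : Formula L} (h : E C (.imp A B))
      (p : Proves E (insert A Γ) B) : Proves E Γ C
  | impE {Γ : Set (Formula L)} {A B C : Formula L} (h : E C (.imp A B))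
      (p : Proves E Γ C) (q : Proves E Γ A) : Proves E Γ B
  | andI {Γ : Set (Formula L)} {A B C : Formula L} (h : E C (.and A B))
      (p : Proves E Γ A) (q : Proves E Γ B) : Proves E Γ C
  | andE₁ {Γ : Set (Formula L)} {A B C : Formula L} (h : E C (.and A B))
      (p : Proves E Γ C) : Proves E Γ A
  | andE₂ {Γ : Set (Formula L)} {A B C : Formula L} (h : E C (.and A B))
      (p : Proves E Γ C) : Proves E Γ B
  | orI₁ {Γ : Set (Formula L)} {A B C : Formula L} (h : E C (.or A B))
      (p : Proves E Γ A) : Proves E Γ C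
  | orI₂ {Γ : Set (Formula L)} {A B C : Formula L} (h : E C (.or A B))
      (p : Proves E Γ B) : Proves E Γ C
  | orE {Γ : Set (Formula L)} {A B C D : Formula L} (h : E D (.or A B))
      (p : Proves E Γ D) (q : Proves E (insert A Γ) C) (r : Proves E (insert B Γ) C) :
      Proves E Γ C
  | topI {Γ : Set (Formula L)} {A : Formula L} (h : E A .top) : Proves E Γ A
  | botE {Γ : Set (Formula L)} {A B : Formula L} (h : E B .bot) (p : Proves E Γ B) :
      Proves E Γ A
  | allI {Γ : Set (Formula L)} {s : L.Srt} {A B : Formula L} (h : E B (.all s A))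
      (p : Proves E (Formula.shift s '' Γ) A) : Proves E Γ B
  | allE {Γ : Set (Formula L)} {s : L.Srt} {A B C : Formula L} (t : Term L s)
      (h : E B (.all s A)) (h' : E C (A.inst t)) (p : Proves E Γ B) : Proves E Γ C
  | exI {Γ : Set (Formula L)} {s : L.Srt} {A B C : Formula L} (t : Term L s)
      (h : E B (.ex s A)) (h' : E C (A.inst t)) (p : Proves E Γ C) : Proves E Γ B
  | exE {Γ : Set (Formula L)} {s : L.Srt} {A B C : Formula L} (h : E C (.ex s A))
      (p : Proves E Γ C) (q : Proves E (insert A (Formula.shift s '' Γ)) (B.shift s)) :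
      Proves E Γ B

/-- Rewrite rules `l ⟶ r` on terms and on propositions; the variables that are free in a rule
may be replaced by arbitrary terms of the same sort. -/
structure RewriteSystem (L : Signature) where
  termRule : (s : L.Srt) → Term L s → Term L s → Prop
  propRule : Formula L → Formula L → Prop

namespace RewriteSystem

/-- The congruence on terms generated by the rules. -/
inductive TermCongr (R : RewriteSystem L) : (s : L.Srt) → Term L s → Term L s → Prop
  | rule {s : L.Srt} {l r : Term L s} (σ : Subst L) (h : R.termRule s l r) :
      TermCongr R s (l.subst σ) (r.subst σ)
  | refl {s : L.Srt} (t : Term L s) : TermCongr R s t t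
  | symm {s : L.Srt} {t u : Term L s} (h : TermCongr R s t u) : TermCongr R s u t
  | trans {s : L.Srt} {t u v : Term L s} (h : TermCongr R s t u) (h' : TermCongr R s u v) :
      TermCongr R s t v
  | func (f : L.Fn) {ts us : (i : Fin (L.fnAr f)) → Term L (L.fnDom f i)}
      (h : ∀ i, TermCongr R (L.fnDom f i) (ts i) (us i)) :
      TermCongr R (L.fnCod f) (.func f ts) (.func f us)

/-- The congruence on propositions generated by the rules. -/
inductive Congr (R : RewriteSystem L) : Formula L → Formula L → Prop
  | rule {l r : Formula L} (σ : Subst L) (h : R.propRule l r) : Congr R (l.subst σ) (r.subst σ)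
  | refl (A : Formula L) : Congr R A A
  | symm {A B : Formula L} (h : Congr R A B) : Congr R B A
  | trans {A B C : Formula L} (h : Congr R A B) (h' : Congr R B C) : Congr R A C
  | rel (r : L.Rel) {ts us : (i : Fin (L.relAr r)) → Term L (L.relDom r i)}
      (h : ∀ i, TermCongr R (L.relDom r i) (ts i) (us i)) : Congr R (.rel r ts) (.rel r us)
  | and {A A' B B' : Formula L} (h : Congr R A A') (h' : Congr R B B') :
      Congr R (.and A B) (.and A' B')
  | or {A A' B B' : Formula L} (h : Congr R A A') (h' : Congr R B B') :
      Congr R (.or A B) (.or A' B')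
  | imp {A A' B B' : Formula L} (h : Congr R A A') (h' : Congr R B B') :
      Congr R (.imp A B) (.imp A' B')
  | all (s : L.Srt) {A A' : Formula L} (h : Congr R A A') : Congr R (.all s A) (.all s A')
  | ex (s : L.Srt) {A A' : Formula L} (h : Congr R A A') : Congr R (.ex s A) (.ex s A')

end RewriteSystem

/-! ## Heyting arithmetic -/

namespace HA

inductive Fn
  | zero
  | succ
  | add
  | mul

abbrev arity : Fn → ℕ
  | .zero => 0
  | .succ => 1
  | .add => 2
  | .mul => 2

/-- The one-sorted language `0, S, +, ×, =`; the only predicate symbol is equality. -/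
abbrev lang : Signature where
  Srt := Unit
  Fn := Fn
  fnAr := arity
  fnDom := fun _ _ => ()
  fnCod := fun _ => ()
  Rel := Unit
  relAr := fun _ => 2
  relDom := fun _ _ => ()

abbrev Tm : Type := Term lang ()
abbrev Fm : Type := Formula lang

def var (n : ℕ) : Tm := Term.var (L := lang) () n
def zero : Tm := Term.func (L := lang) Fn.zero (fun i => Fin.elim0 i)
def succ (t : Tm) : Tm := Term.func (L := lang) Fn.succ (fun _ => t)
def add (t u : Tm) : Tm := Term.func (L := lang) Fn.add (![t, u] : Fin 2 → Tm)
def mul (t u : Tm) : Tm := Term.func (L := lang) Fn.mul (![t, u] : Fin 2 → Tm)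
def eq (t u : Tm) : Fm := Formula.rel (L := lang) () (![t, u] : Fin 2 → Tm)
abbrev all (A : Fm) : Fm := Formula.all (L := lang) () A

/-- The substitution `S(y)/x`, where both `x` and `y` have index `0`. -/
def succSubst : Subst lang
  | _, 0 => succ (var 0)
  | _, n + 1 => var (n + 1)

/-- `(0/x)P ⇒ ∀ y, ((y/x)P ⇒ (S(y)/x)P) ⇒ ∀ n, (n/x)P`, where `x` has index `0` in `P`. -/
def induction (P : Fm) : Fm :=
  .imp (P.inst zero) (.imp (all (.imp P (P.subst succSubst))) (all P))

/-- The axioms of Heyting arithmetic; the instances of the induction scheme are universally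
closed over the parameters of the induction proposition. -/
inductive Axiom : Set Fm
  | eq_refl : Axiom (all (eq (var 0) (var 0)))
  | eq_symm : Axiom (all (all (.imp (eq (var 1) (var 0)) (eq (var 0) (var 1)))))
  | eq_trans : Axiom (all (all (all
      (.imp (eq (var 2) (var 1)) (.imp (eq (var 1) (var 0)) (eq (var 2) (var 0)))))))
  | eq_succ : Axiom (all (all (.imp (eq (var 1) (var 0)) (eq (succ (var 1)) (succ (var 0))))))
  | eq_add : Axiom (all (all (all (all (.imp (eq (var 3) (var 2)) (.imp (eq (var 1) (var 0))
      (eq (add (var 3) (var 1)) (add (var 2) (var 0)))))))))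
  | eq_mul : Axiom (all (all (all (all (.imp (eq (var 3) (var 2)) (.imp (eq (var 1) (var 0))
      (eq (mul (var 3) (var 1)) (mul (var 2) (var 0)))))))))
  | succ_inj : Axiom (all (all (.imp (eq (succ (var 1)) (succ (var 0))) (eq (var 1) (var 0)))))
  | zero_ne_succ : Axiom (all (Formula.neg (eq zero (succ (var 0)))))
  | induct (n : ℕ) (P : Fm) (hP : P.Bounded (fun _ => n + 1)) :
      Axiom (Formula.allN (L := lang) () n (induction P))
  | zero_add : Axiom (all (eq (add zero (var 0)) (var 0)))
  | succ_add : Axiom (all (all (eq (add (succ (var 1)) (var 0)) (succ (add (var 1) (var 0))))))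
  | zero_mul : Axiom (all (eq (mul zero (var 0)) zero))
  | succ_mul : Axiom (all (all
      (eq (mul (succ (var 1)) (var 0)) (add (mul (var 1) (var 0)) (var 0)))))

/-- Provability in HA: the congruence is equality of propositions. -/
def Provable (A : Fm) : Prop := Proves (L := lang) (fun B C => B = C) Axiom A

end HA

/-! ## The one-sorted language with `Pred`, `Null` and `N` -/

namespace HAN

inductive Fn
  | ha (f : HA.Fn)
  | pred

abbrev arity : Fn → ℕ
  | .ha f => HA.arity f
  | .pred => 1

inductive Rel
  | eq
  | null
  | nat

abbrev relArity : Rel → ℕ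
  | .eq => 2
  | .null => 1
  | .nat => 1

/-- The one-sorted language `0, S, +, ×, Pred, =, Null, N`. -/
abbrev lang : Signature where
  Srt := Unit
  Fn := Fn
  fnAr := arity
  fnDom := fun _ _ => ()
  fnCod := fun _ => ()
  Rel := Rel
  relAr := relArity
  relDom := fun _ _ => ()

abbrev Tm : Type := Term lang ()
abbrev Fm : Type := Formula lang

def var (n : ℕ) : Tm := Term.var (L := lang) () n
def nat (t : Tm) : Fm := Formula.rel (L := lang) Rel.nat (fun _ => t)

/-- A term of the language of HA, seen in this language. -/
def ofHATerm : {s : HA.lang.Srt} → Term HA.lang s → Tm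
  | _, .var _ n => var n
  | _, .func f ts => Term.func (L := lang) (Fn.ha f) (fun i => ofHATerm (ts i))

/-- The translation `|A|`, which relativizes the quantifiers to `N`. -/
def translate : HA.Fm → Fm
  | .rel _ ts => Formula.rel (L := lang) Rel.eq (fun i => ofHATerm (ts i))
  | .top => .top
  | .bot => .bot
  | .and A B => .and (translate A) (translate B)
  | .or A B => .or (translate A) (translate B)
  | .imp A B => .imp (translate A) (translate B)
  | .all _ A => Formula.all (L := lang) () (.imp (nat (var 0)) (translate A))
  | .ex _ A => Formula.ex (L := lang) () (.and (nat (var 0)) (translate A))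

end HAN

/-! ## The two-sorted theory with rewrite rules only -/

namespace HAModulo

/-- The sorts: `num` for numbers and `cls` for classes of numbers. -/
inductive Srt
  | num
  | cls
  deriving DecidableEq

/-- Besides `0, S, +, ×, Pred`, there is a symbol `f_P`, of `n` arguments `y₁, …, yₙ`, for each
proposition `P` of the one-sorted language with `Pred`, `Null`, `N` whose free variables are
among `x, y₁, …, yₙ`; `x` has index `0` and `yᵢ` has index `i` in `P`. -/
inductive Fn
  | arith (f : HAN.Fn)
  | comp (n : ℕ) (P : HAN.Fm) (hP : P.Bounded (fun _ => n + 1))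

abbrev arity : Fn → ℕ
  | .arith f => HAN.arity f
  | .comp n _ _ => n

abbrev fnCod : Fn → Srt
  | .arith _ => .num
  | .comp _ _ _ => .cls

inductive Rel
  | arith (r : HAN.Rel)
  | mem

abbrev relArity : Rel → ℕ
  | .arith r => HAN.relArity r
  | .mem => 2

abbrev relDom : (r : Rel) → Fin (relArity r) → Srt
  | .arith _ => fun _ => .num
  | .mem => (![.num, .cls] : Fin 2 → Srt)

/-- The two-sorted language `0, S, +, ×, Pred, f_P, =, Null, N, ∈`. -/
abbrev lang : Signature where
  Srt := Srt
  Fn := Fn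
  fnAr := arity
  fnDom := fun _ _ => .num
  fnCod := fnCod
  Rel := Rel
  relAr := relArity
  relDom := relDom

abbrev NumTm : Type := Term lang Srt.num
abbrev ClsTm : Type := Term lang Srt.cls
abbrev Fm : Type := Formula lang

def nvar (n : ℕ) : NumTm := Term.var (L := lang) Srt.num n
def cvar (n : ℕ) : ClsTm := Term.var (L := lang) Srt.cls n
def zero : NumTm := Term.func (L := lang) (Fn.arith (.ha .zero)) (fun i => Fin.elim0 i)
def succ (t : NumTm) : NumTm := Term.func (L := lang) (Fn.arith (.ha .succ)) (fun _ => t)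
def pred (t : NumTm) : NumTm := Term.func (L := lang) (Fn.arith .pred) (fun _ => t)
def add (t u : NumTm) : NumTm :=
  Term.func (L := lang) (Fn.arith (.ha .add)) (![t, u] : Fin 2 → NumTm)
def mul (t u : NumTm) : NumTm :=
  Term.func (L := lang) (Fn.arith (.ha .mul)) (![t, u] : Fin 2 → NumTm)
def comp (n : ℕ) (P : HAN.Fm) (hP : P.Bounded (fun _ => n + 1)) (ts : Fin n → NumTm) : ClsTm :=
  Term.func (L := lang) (Fn.comp n P hP) ts
def eq (t u : NumTm) : Fm :=
  Formula.rel (L := lang) (Rel.arith .eq) (![t, u] : Fin 2 → NumTm)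
def null (t : NumTm) : Fm := Formula.rel (L := lang) (Rel.arith .null) (fun _ => t)
def nat (t : NumTm) : Fm := Formula.rel (L := lang) (Rel.arith .nat) (fun _ => t)
def memArgs (t : NumTm) (c : ClsTm) : (i : Fin 2) → Term lang (relDom Rel.mem i)
  | 0 => t
  | 1 => c
def mem (t : NumTm) (c : ClsTm) : Fm := Formula.rel (L := lang) Rel.mem (memArgs t c)
abbrev allNum (A : Fm) : Fm := Formula.all (L := lang) Srt.num A
abbrev exNum (A : Fm) : Fm := Formula.ex (L := lang) Srt.num A
abbrev allCls (A : Fm) : Fm := Formula.all (L := lang) Srt.cls A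

/-- A term of the one-sorted language, seen as a term of sort `num`. -/
def ofHANTerm : {s : HAN.lang.Srt} → Term HAN.lang s → NumTm
  | _, .var _ n => nvar n
  | _, .func f ts => Term.func (L := lang) (Fn.arith f) (fun i => ofHANTerm (ts i))

/-- A proposition of the one-sorted language, seen in the two-sorted one. -/
def ofHAN : HAN.Fm → Fm
  | .rel r ts => Formula.rel (L := lang) (Rel.arith r) (fun i => ofHANTerm (ts i))
  | .top => .top
  | .bot => .bot
  | .and A B => .and (ofHAN A) (ofHAN B)
  | .or A B => .or (ofHAN A) (ofHAN B)
  | .imp A B => .imp (ofHAN A) (ofHAN B)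
  | .all _ A => allNum (ofHAN A)
  | .ex _ A => exNum (ofHAN A)

/-- The rewrite rules on terms (there are none for terms of sort `cls`). -/
inductive TermRule : (s : Srt) → Term lang s → Term lang s → Prop
  | pred_zero : TermRule .num (pred zero) zero
  | pred_succ : TermRule .num (pred (succ (nvar 0))) (nvar 0)
  | zero_add : TermRule .num (add zero (nvar 0)) (nvar 0)
  | succ_add : TermRule .num (add (succ (nvar 1)) (nvar 0)) (succ (add (nvar 1) (nvar 0)))
  | zero_mul : TermRule .num (mul zero (nvar 0)) zero
  | succ_mul : TermRule .num (mul (succ (nvar 1)) (nvar 0)) (add (mul (nvar 1) (nvar 0)) (nvar 0))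

/-- The rewrite rules on propositions: Leibniz equality, the impredicative definition of `N`,
comprehension and the rules for `Null`. The two sorts are numbered independently, so that a
quantifier over classes does not raise the indices of number variables. -/
inductive PropRule : Fm → Fm → Prop
  | eq : PropRule (eq (nvar 1) (nvar 0))
      (allCls (.imp (mem (nvar 1) (cvar 0)) (mem (nvar 0) (cvar 0))))
  | nat : PropRule (nat (nvar 0))
      (allCls (.imp (mem zero (cvar 0))
        (.imp (allNum (.imp (nat (nvar 0))
          (.imp (mem (nvar 0) (cvar 0)) (mem (succ (nvar 0)) (cvar 0)))))
        (mem (nvar 0) (cvar 0)))))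
  | comp (n : ℕ) (P : HAN.Fm) (hP : P.Bounded (fun _ => n + 1)) :
      PropRule (mem (nvar 0) (comp n P hP (fun i => nvar ((i : ℕ) + 1)))) (ofHAN P)
  | null_zero : PropRule (null zero) .top
  | null_succ : PropRule (null (succ (nvar 0))) .bot

/-- The rewrite system of `HA_→`. -/
def rules : RewriteSystem lang where
  termRule := TermRule
  propRule := PropRule

/-- Provability in `HA_→`: no axioms, deduction modulo the congruence of the rewrite rules. -/
def Provable (A : Fm) : Prop := Proves (L := lang) rules.Congr ∅ A

end HAModulo

end DedMod

/-! Both directions are semantic. Every theory has a term model with values in the MacNeille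
completion of its Lindenbaum algebra. This completion is a frame, and it preserves the connectives
and the quantifiers, read as infima and suprema over terms (`Theory.termModel_val`). A proposition
therefore has value `⊤` in it exactly when it is provable. Natural deduction modulo is sound for
frame-valued models that give congruent propositions equal values (`Model.le_val_of_proves`). The
whole argument is constructive in spirit: truth of `A` is replaced by inequalities `z ≤ val A`, with
`z` a stage.

From HA to the theory modulo: in the term model of the rewrite rules, restrict the quantifiers to
`N`. The Leibniz rule with comprehension gives the equality axioms, `Pred` gives injectivity of `S`,
`Null` separates `0` from successors, and the rule for `N` with comprehension gives induction. Since
`N` is closed under the operations, soundness applies to this restricted model.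

From the theory modulo to HA: a model `M` of HA must be enlarged to a model of the rewrite rules.
The term rules require actual equality of values, while `M` only has an `H`-valued equality and no
operation for `Pred`. So numbers are taken to be the frame-valued singletons `Pt M`, that is,
elements given by a unique description. On them the recursion equations and those of `Pred` hold on
the nose, and `N` is constantly true. Classes are the extensional predicates for which induction
holds, so the rule for `N` is valid by construction.

The crux is comprehension: the predicate defined by a proposition with `Pred`, `Null` and `N` must
be such a class. This follows from `exists_tracks`: once the parameters are locally given elements
of `M`, the proposition is equivalent to one of HA, for which induction is an axiom. A proposition
of HA is moreover tracked by itself (`tracks_self`), so passing to `Pt M` does not change the truth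
of closed propositions. Taking for `M` the term model of HA gives provability. -/

namespace DedMod

variable {L : Signature}

/-! ### Environments -/

/-- An assignment of elements of a family of carriers to the variables. -/
abbrev Env (L : Signature) (M : L.Srt → Type) : Type := (s : L.Srt) → ℕ → M s

namespace Env

variable {M : L.Srt → Type}

/-- Insert a value for the variable of sort `s` with index `0`. -/
def cons {s : L.Srt} (m : M s) (ρ : Env L M) : Env L M :=
  fun s' n =>
    if h : s' = s then
      match n with
      | 0 => h ▸ m
      | k + 1 => ρ s' k
    else ρ s' n

@[simp] theorem cons_zero {s : L.Srt} (m : M s) (ρ : Env L M) : cons m ρ s 0 = m := by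
  simp [cons]

@[simp] theorem cons_succ {s : L.Srt} (m : M s) (ρ : Env L M) (n : ℕ) :
    cons m ρ s (n + 1) = ρ s n := by
  simp [cons]

theorem cons_of_ne {s s' : L.Srt} (h : s' ≠ s) (m : M s) (ρ : Env L M) (n : ℕ) :
    cons m ρ s' n = ρ s' n := by
  simp [cons, h]

theorem eq_cons {s : L.Srt} {m : M s} {ρ ρ' : Env L M} (h0 : ρ' s 0 = m)
    (h1 : ∀ n, ρ' s (n + 1) = ρ s n) (h2 : ∀ s' n, s' ≠ s → ρ' s' n = ρ s' n) :
    ρ' = cons m ρ := by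
  funext s' n
  by_cases h : s' = s
  · subst h
    cases n with
    | zero => simp [h0]
    | succ n => simp [h1]
  · rw [cons_of_ne h, h2 _ _ h]

end Env

/-! ### Substitution -/

namespace Subst

/-- First `σ`, then `τ`. -/
def comp (σ τ : Subst L) : Subst L := fun s n => (σ s n).subst τ

theorem shift_same (s : L.Srt) (n : ℕ) : shift s s n = .var s (n + 1) := by simp [shift]

theorem shift_of_ne {s s' : L.Srt} (h : s' ≠ s) (n : ℕ) : shift s s' n = .var s' n := by
  simp [shift, h]

/-- A substitution is an environment of terms. Reducing `up` and `inst` to `Env.cons` turns the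
substitution calculus into a few composition laws, without case splits on sorts. -/
theorem up_eq_cons (s : L.Srt) (σ : Subst L) :
    up s σ = Env.cons (M := Term L) (.var s 0) (σ.comp (shift s)) := by
  apply Env.eq_cons
  · simp [up]
  · intro n; simp [up, comp]
  · intro s' n h; simp [up, comp, h]

theorem inst_eq_cons {s : L.Srt} (t : Term L s) :
    inst t = Env.cons (M := Term L) t (fun s n => .var s n) := by
  apply Env.eq_cons
  · simp [inst]
  · intro n; simp [inst]
  · intro s' n h; simp [inst, h]

end Subst

theorem Term.subst_subst (σ τ : Subst L) {s : L.Srt} (t : Term L s) :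
    (t.subst σ).subst τ = t.subst (σ.comp τ) := by
  induction t with
  | var s n => rfl
  | func f ts ih => simp [Term.subst, ih]

theorem Term.subst_var {s : L.Srt} (t : Term L s) : t.subst (fun s n => .var s n) = t := by
  induction t with
  | var s n => rfl
  | func f ts ih => simp [Term.subst, ih]

namespace Subst

theorem comp_assoc (σ τ υ : Subst L) : (σ.comp τ).comp υ = σ.comp (τ.comp υ) := by
  funext s n; exact Term.subst_subst _ _ _

theorem comp_var (σ : Subst L) : σ.comp (fun s n => .var s n) = σ := by
  funext s n; exact Term.subst_var _

theorem cons_comp {s : L.Srt} (t : Term L s) (σ τ : Subst L) :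
    Subst.comp (Env.cons (M := Term L) t σ) τ =
      Env.cons (M := Term L) (t.subst τ) (σ.comp τ) := by
  apply Env.eq_cons
  · simp [comp]
  · intro n; simp [comp]
  · intro s' n h; simp [comp, Env.cons_of_ne h]

theorem shift_comp_cons {s : L.Srt} (t : Term L s) (σ : Subst L) :
    (shift s).comp (Env.cons (M := Term L) t σ) = σ := by
  funext s' n
  by_cases h : s' = s
  · subst h; simp [comp, shift_same, Term.subst]
  · simp [comp, shift_of_ne h, Term.subst, Env.cons_of_ne h]

theorem up_comp_cons {s : L.Srt} (t : Term L s) (σ τ : Subst L) :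
    (up s σ).comp (Env.cons (M := Term L) t τ) = Env.cons (M := Term L) t (σ.comp τ) := by
  rw [up_eq_cons, cons_comp, comp_assoc, shift_comp_cons]
  simp [Term.subst]

theorem up_comp (s : L.Srt) (σ τ : Subst L) : (up s σ).comp (up s τ) = up s (σ.comp τ) := by
  rw [up_eq_cons s τ, up_comp_cons, up_eq_cons, comp_assoc]

theorem shift_comp_up (s : L.Srt) (σ : Subst L) :
    (shift s).comp (up s σ) = σ.comp (shift s) := by
  rw [up_eq_cons, shift_comp_cons]

theorem up_var (s : L.Srt) : up s (fun s n => .var s n) = (fun s n => .var s n : Subst L) := by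
  rw [up_eq_cons]
  symm
  apply Env.eq_cons
  · rfl
  · intro n; simp [comp, Term.subst, shift_same]
  · intro s' n h; simp [comp, Term.subst, shift_of_ne h]

end Subst

namespace Formula

theorem subst_subst (σ τ : Subst L) (A : Formula L) :
    (A.subst σ).subst τ = A.subst (σ.comp τ) := by
  induction A generalizing σ τ <;> simp_all [subst, Term.subst_subst, Subst.up_comp]

theorem subst_var (A : Formula L) : A.subst (fun s n => .var s n) = A := by
  induction A <;> simp_all [subst, Term.subst_var, Subst.up_var]

theorem inst_subst_up {s : L.Srt} (σ : Subst L) (t : Term L s) (A : Formula L) :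
    (A.subst (Subst.up s σ)).inst t = A.subst (Env.cons (M := Term L) t σ) := by
  rw [inst, subst_subst, Subst.inst_eq_cons, Subst.up_comp_cons, Subst.comp_var]

theorem subst_inst {s : L.Srt} (σ : Subst L) (t : Term L s) (A : Formula L) :
    (A.inst t).subst σ = (A.subst (Subst.up s σ)).inst (t.subst σ) := by
  rw [inst_subst_up, inst, subst_subst, Subst.inst_eq_cons, Subst.cons_comp]
  rfl

theorem shift_subst_up (s : L.Srt) (σ : Subst L) (A : Formula L) :
    (A.shift s).subst (Subst.up s σ) = (A.subst σ).shift s := by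
  rw [shift, subst_subst, Subst.shift_comp_up, shift, subst_subst]

end Formula

/-! ### Bounds on the free variables -/

theorem Term.Bounded.mono {k k' : L.Srt → ℕ} (h : k ≤ k') {s : L.Srt} {t : Term L s}
    (ht : t.Bounded k) : t.Bounded k' := by
  induction t with
  | var s n => exact lt_of_lt_of_le ht (h s)
  | func f ts ih => exact fun i => ih i (ht i)

theorem Formula.Bounded.mono {k k' : L.Srt → ℕ} (h : k ≤ k') {A : Formula L}
    (hA : A.Bounded k) : A.Bounded k' := by
  induction A generalizing k k' with
  | rel r ts => exact fun i => (hA i).mono h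
  | top => trivial
  | bot => trivial
  | and A B ihA ihB => exact ⟨ihA h hA.1, ihB h hA.2⟩
  | or A B ihA ihB => exact ⟨ihA h hA.1, ihB h hA.2⟩
  | imp A B ihA ihB => exact ⟨ihA h hA.1, ihB h hA.2⟩
  | all s A ih =>
    exact ih (update_le_update_iff.2 ⟨Nat.succ_le_succ (h s), fun j _ => h j⟩) hA
  | ex s A ih =>
    exact ih (update_le_update_iff.2 ⟨Nat.succ_le_succ (h s), fun j _ => h j⟩) hA

/-- Arities are finite, so the pointwise supremum of the bounds of the arguments is a common bound.
-/
theorem exists_bound_forall {n : ℕ} {p : Fin n → (L.Srt → ℕ) → Prop}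
    (mono : ∀ i k k', k ≤ k' → p i k → p i k') (h : ∀ i, ∃ k, p i k) : ∃ k, ∀ i, p i k := by
  choose k hk using h
  exact ⟨fun s => Finset.univ.sup fun i => k i s, fun i => mono i _ _
    (fun s => Finset.le_sup (f := fun i => k i s) (Finset.mem_univ i)) (hk i)⟩

theorem Term.exists_bounded {s : L.Srt} (t : Term L s) : ∃ k, t.Bounded k := by
  induction t with
  | var s n => exact ⟨fun _ => n + 1, Nat.lt_succ_self n⟩
  | func f ts ih => exact exists_bound_forall (fun i _ _ h ht => Term.Bounded.mono h ht) ih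

theorem Formula.exists_bounded (A : Formula L) : ∃ k, A.Bounded k := by
  have two : ∀ {A B : Formula L}, (∃ k, A.Bounded k) → (∃ k, B.Bounded k) →
      ∃ k, A.Bounded k ∧ B.Bounded k := by
    rintro A B ⟨k, hk⟩ ⟨k', hk'⟩
    exact ⟨k ⊔ k', hk.mono le_sup_left, hk'.mono le_sup_right⟩
  have up : ∀ {A : Formula L} (s : L.Srt), (∃ k, A.Bounded k) →
      ∃ k, A.Bounded (Function.update k s (k s + 1)) := by
    rintro A s ⟨k, hk⟩
    exact ⟨k, hk.mono (le_update_iff.2 ⟨Nat.le_succ _, fun _ _ => le_rfl⟩)⟩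
  induction A with
  | rel r ts =>
    exact exists_bound_forall (fun i _ _ h ht => Term.Bounded.mono h ht)
      fun i => (ts i).exists_bounded
  | top => exact ⟨0, trivial⟩
  | bot => exact ⟨0, trivial⟩
  | and A B ihA ihB => exact two ihA ihB
  | or A B ihA ihB => exact two ihA ihB
  | imp A B ihA ihB => exact two ihA ihB
  | all s A ih => exact up s ih
  | ex s A ih => exact up s ih

theorem Term.subst_congr {k : L.Srt → ℕ} {σ τ : Subst L} (h : ∀ s, ∀ n < k s, σ s n = τ s n)
    {s : L.Srt} {t : Term L s} (ht : t.Bounded k) : t.subst σ = t.subst τ := by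
  induction t with
  | var s n => exact h s n ht
  | func f ts ih => simp only [Term.subst]; congr 1; funext i; exact ih i (ht i)

theorem Env.cons_congr {M : L.Srt → Type} {k : L.Srt → ℕ} {ρ ρ' : Env L M}
    (h : ∀ s, ∀ n < k s, ρ s n = ρ' s n) {s : L.Srt} (m : M s) :
    ∀ s', ∀ n < Function.update k s (k s + 1) s', Env.cons m ρ s' n = Env.cons m ρ' s' n := by
  intro s' n hn
  by_cases hs : s' = s
  · subst hs
    rw [Function.update_self] at hn
    cases n with
    | zero => simp
    | succ n => simpa using h _ n (by omega)
  · rw [Function.update_of_ne hs] at hn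
    simpa [Env.cons_of_ne hs] using h _ n hn

theorem Formula.subst_congr {k : L.Srt → ℕ} {σ τ : Subst L} (h : ∀ s, ∀ n < k s, σ s n = τ s n)
    {A : Formula L} (hA : A.Bounded k) : A.subst σ = A.subst τ := by
  have up : ∀ {k : L.Srt → ℕ} {σ τ : Subst L} (_ : ∀ s, ∀ n < k s, σ s n = τ s n) (s : L.Srt),
      ∀ s', ∀ n < Function.update k s (k s + 1) s',
        Subst.up s σ s' n = Subst.up s τ s' n := by
    intro k σ τ h s
    rw [Subst.up_eq_cons, Subst.up_eq_cons]
    exact Env.cons_congr (fun s n hn => by simp only [Subst.comp, h s n hn]) _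
  induction A generalizing k σ τ with
  | rel r ts =>
    simp only [subst]; congr 1; funext i; exact Term.subst_congr h (hA i)
  | top => rfl
  | bot => rfl
  | and A B ihA ihB => simp only [subst, ihA h hA.1, ihB h hA.2]
  | or A B ihA ihB => simp only [subst, ihA h hA.1, ihB h hA.2]
  | imp A B ihA ihB => simp only [subst, ihA h hA.1, ihB h hA.2]
  | all s A ih => simp only [subst, ih (up h s) hA]
  | ex s A ih => simp only [subst, ih (up h s) hA]

theorem Formula.Closed.subst_eq {A : Formula L} (hA : A.Closed) (σ : Subst L) : A.subst σ = A :=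
  (Formula.subst_congr (τ := fun s n => .var s n)
    (fun _ _ h => absurd h (Nat.not_lt_zero _)) hA).trans A.subst_var

theorem Term.Bounded.subst {k k' : L.Srt → ℕ} {σ : Subst L}
    (h : ∀ s, ∀ n < k s, (σ s n).Bounded k') {s : L.Srt} {t : Term L s} (ht : t.Bounded k) :
    (t.subst σ).Bounded k' := by
  induction t with
  | var s n => exact h s n ht
  | func f ts ih => exact fun i => ih i (ht i)

theorem Formula.Bounded.subst {k k' : L.Srt → ℕ} {σ : Subst L}
    (h : ∀ s, ∀ n < k s, (σ s n).Bounded k') {A : Formula L} (hA : A.Bounded k) :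
    (A.subst σ).Bounded k' := by
  have up : ∀ {k k' : L.Srt → ℕ} {σ : Subst L} (_ : ∀ s, ∀ n < k s, (σ s n).Bounded k')
      (s : L.Srt), ∀ s', ∀ n < Function.update k s (k s + 1) s',
        (Subst.up s σ s' n).Bounded (Function.update k' s (k' s + 1)) := by
    intro k k' σ h s s' n hn
    have sh : ∀ {s'} {t : Term L s'}, t.Bounded k' →
        (t.subst (Subst.shift s)).Bounded (Function.update k' s (k' s + 1)) := by
      intro s' t ht
      refine ht.subst fun s'' m hm => ?_
      by_cases hs : s'' = s
      · subst hs; simpa [Subst.shift_same, Term.Bounded] using hm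
      · simpa [Subst.shift_of_ne hs, Term.Bounded, Function.update_of_ne hs] using hm
    rw [Subst.up_eq_cons]
    by_cases hs : s' = s
    · subst hs
      rw [Function.update_self] at hn
      cases n with
      | zero => simp [Term.Bounded]
      | succ n => simpa [Subst.comp] using sh (h _ n (by omega))
    · rw [Function.update_of_ne hs] at hn
      simpa [Env.cons_of_ne hs, Subst.comp] using sh (h _ n hn)
  induction A generalizing k k' σ with
  | rel r ts => exact fun i => (hA i).subst h
  | top => trivial
  | bot => trivial
  | and A B ihA ihB => exact ⟨ihA h hA.1, ihB h hA.2⟩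
  | or A B ihA ihB => exact ⟨ihA h hA.1, ihB h hA.2⟩
  | imp A B ihA ihB => exact ⟨ihA h hA.1, ihB h hA.2⟩
  | all s A ih => exact ih (up h s) hA
  | ex s A ih => exact ih (up h s) hA

theorem Formula.Bounded.allN {s : L.Srt} {A : Formula L} (n : ℕ) {k : L.Srt → ℕ}
    (hA : A.Bounded (Function.update k s (k s + n))) : (Formula.allN s n A).Bounded k := by
  induction n generalizing k with
  | zero => simpa [Formula.allN] using hA
  | succ n ih =>
    apply ih
    simpa [Nat.add_assoc, Nat.add_comm 1 n] using hA

/-! ### Weakening and substitution in proofs -/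

variable {E : Formula L → Formula L → Prop}

theorem Proves.mono {Γ Δ : Set (Formula L)} {A : Formula L} (p : Proves E Γ A) (h : Γ ⊆ Δ) :
    Proves E Δ A := by
  induction p generalizing Δ with
  | ax hA hE => exact .ax (h hA) hE
  | impI hE _ ih => exact .impI hE (ih (Set.insert_subset_insert h))
  | impE hE _ _ ih ih' => exact .impE hE (ih h) (ih' h)
  | andI hE _ _ ih ih' => exact .andI hE (ih h) (ih' h)
  | andE₁ hE _ ih => exact .andE₁ hE (ih h)
  | andE₂ hE _ ih => exact .andE₂ hE (ih h)
  | orI₁ hE _ ih => exact .orI₁ hE (ih h)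
  | orI₂ hE _ ih => exact .orI₂ hE (ih h)
  | orE hE _ _ _ ih ih' ih'' =>
    exact .orE hE (ih h) (ih' (Set.insert_subset_insert h)) (ih'' (Set.insert_subset_insert h))
  | topI hE => exact .topI hE
  | botE hE _ ih => exact .botE hE (ih h)
  | allI hE _ ih => exact .allI hE (ih (Set.image_mono h))
  | allE t hE hE' _ ih => exact .allE t hE hE' (ih h)
  | exI t hE hE' _ ih => exact .exI t hE hE' (ih h)
  | exE hE _ _ ih ih' =>
    exact .exE hE (ih h) (ih' (Set.insert_subset_insert (Set.image_mono h)))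

/-- Used to turn a proof about a fresh free variable into one about a bound variable, as the
eigenvariable rules require. -/
theorem Proves.subst (hE : ∀ σ A B, E A B → E (A.subst σ) (B.subst σ)) {Γ : Set (Formula L)}
    {A : Formula L} (p : Proves E Γ A) (σ : Subst L) :
    Proves E (Formula.subst σ '' Γ) (A.subst σ) := by
  have sh : ∀ (s : L.Srt) (σ : Subst L) (Γ : Set (Formula L)),
      Formula.subst (Subst.up s σ) '' (Formula.shift s '' Γ) =
        Formula.shift s '' (Formula.subst σ '' Γ) := by
    intro s σ Γ
    simp only [Set.image_image, Formula.shift_subst_up]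
  induction p generalizing σ with
  | ax hA h => exact .ax (Set.mem_image_of_mem _ hA) (hE σ _ _ h)
  | impI h _ ih => exact .impI (hE σ _ _ h) (by simpa [Set.image_insert_eq] using ih σ)
  | impE h _ _ ih ih' => exact .impE (hE σ _ _ h) (ih σ) (ih' σ)
  | andI h _ _ ih ih' => exact .andI (hE σ _ _ h) (ih σ) (ih' σ)
  | andE₁ h _ ih => exact .andE₁ (hE σ _ _ h) (ih σ)
  | andE₂ h _ ih => exact .andE₂ (hE σ _ _ h) (ih σ)
  | orI₁ h _ ih => exact .orI₁ (hE σ _ _ h) (ih σ)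
  | orI₂ h _ ih => exact .orI₂ (hE σ _ _ h) (ih σ)
  | orE h _ _ _ ih ih' ih'' =>
    exact .orE (hE σ _ _ h) (ih σ) (by simpa [Set.image_insert_eq] using ih' σ)
      (by simpa [Set.image_insert_eq] using ih'' σ)
  | topI h => exact .topI (hE σ _ _ h)
  | botE h _ ih => exact .botE (hE σ _ _ h) (ih σ)
  | allI h _ ih => exact .allI (hE σ _ _ h) (sh _ σ _ ▸ ih (Subst.up _ σ))
  | allE t h h' _ ih =>
    exact .allE (t.subst σ) (hE σ _ _ h) (by simpa only [Formula.subst_inst] using hE σ _ _ h')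
      (ih σ)
  | exI t h h' _ ih =>
    exact .exI (t.subst σ) (hE σ _ _ h) (by simpa only [Formula.subst_inst] using hE σ _ _ h')
      (ih σ)
  | @exE _ s _ _ _ h _ _ ih ih' =>
    refine .exE (hE σ _ _ h) (ih σ) ?_
    have := ih' (Subst.up s σ)
    rwa [Set.image_insert_eq, sh, Formula.shift_subst_up] at this

/-! ### The completed Lindenbaum algebra of a theory -/

/-- A theory in deduction modulo: a congruence and a set of axioms, both stable under
substitution. -/
structure Theory (L : Signature) where
  congr : Formula L → Formula L → Prop
  axioms : Set (Formula L)
  congr_refl : ∀ A, congr A A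
  congr_subst : ∀ σ A B, congr A B → congr (A.subst σ) (B.subst σ)
  axioms_subst : ∀ A ∈ axioms, ∀ σ, A.subst σ = A

namespace Theory

variable (T : Theory L)

/-- Provability in the theory. -/
abbrev Provable (A : Formula L) : Prop := Proves T.congr T.axioms A

/-- `B` is provable in the theory from the hypothesis `A`. -/
abbrev Entails (A B : Formula L) : Prop := Proves T.congr (insert A T.axioms) B

variable {T}

theorem Entails.of_congr {A B : Formula L} (h : T.congr A B) : T.Entails A B :=
  .ax (Set.mem_insert _ _) h

theorem Entails.refl (A : Formula L) : T.Entails A A := .of_congr (T.congr_refl A)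

theorem Entails.trans {A B C : Formula L} (h : T.Entails A B) (h' : T.Entails B C) :
    T.Entails A C :=
  .impE (T.congr_refl _)
    (Proves.mono (.impI (T.congr_refl _) h') (Set.subset_insert _ _)) h

theorem Entails.and_iff {A B C : Formula L} :
    T.Entails C (.and A B) ↔ T.Entails C A ∧ T.Entails C B :=
  ⟨fun h => ⟨.andE₁ (T.congr_refl _) h, .andE₂ (T.congr_refl _) h⟩,
    fun h => .andI (T.congr_refl _) h.1 h.2⟩

theorem Entails.or_iff {A B C : Formula L} :
    T.Entails (.or A B) C ↔ T.Entails A C ∧ T.Entails B C := by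
  refine ⟨fun h => ⟨trans (.orI₁ (T.congr_refl _) (refl A)) h,
    trans (.orI₂ (T.congr_refl _) (refl B)) h⟩, fun h => ?_⟩
  exact .orE (T.congr_refl _) (refl _)
    (Proves.mono h.1 (Set.insert_subset_insert (Set.subset_insert _ _)))
    (Proves.mono h.2 (Set.insert_subset_insert (Set.subset_insert _ _)))

theorem Entails.imp_iff {A B C : Formula L} :
    T.Entails C (.imp A B) ↔ T.Entails (.and C A) B := by
  constructor
  · intro h
    exact .impE (T.congr_refl _) (trans (and_iff.1 (refl _)).1 h) (and_iff.1 (refl _)).2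
  · intro h
    refine .impI (T.congr_refl _) ?_
    refine .impE (T.congr_refl (.imp (.and C A) B))
      (Proves.mono (.impI (T.congr_refl _) h)
        ((Set.subset_insert _ _).trans (Set.subset_insert _ _))) ?_
    exact .andI (T.congr_refl _)
      (.ax (Set.mem_insert_of_mem _ (Set.mem_insert _ _)) (T.congr_refl _))
      (.ax (Set.mem_insert _ _) (T.congr_refl _))

theorem image_subst_axioms (σ : Subst L) : Formula.subst σ '' T.axioms = T.axioms := by
  refine (Set.image_congr fun A hA => T.axioms_subst A hA σ).trans (Set.image_id' _)

theorem Entails.subst {A B : Formula L} (h : T.Entails A B) (σ : Subst L) :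
    T.Entails (A.subst σ) (B.subst σ) := by
  have := Proves.subst T.congr_subst h σ
  rwa [Set.image_insert_eq, image_subst_axioms] at this

/-- The substitution that makes the variable `n` of sort `s` the bound one. -/
def bindVar (s : L.Srt) (n : ℕ) : Subst L :=
  fun s' m => if s' = s ∧ m = n then .var s' 0 else Subst.shift s s' m

theorem subst_bindVar {s : L.Srt} {n : ℕ} {k : L.Srt → ℕ} {A : Formula L} (hA : A.Bounded k)
    (hn : k s ≤ n) : A.subst (bindVar s n) = A.shift s := by
  refine Formula.subst_congr (fun s' m hm => ?_) hA
  have : ¬(s' = s ∧ m = n) := by rintro ⟨rfl, rfl⟩; omega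
  simp [bindVar, this]

/-- A variable above all the free ones acts as a fresh constant, so generalizing over it recovers
the matrix. -/
theorem inst_var_subst_bindVar {s : L.Srt} {n : ℕ} {k : L.Srt → ℕ} {A : Formula L}
    (hA : A.Bounded k) (hn : k s ≤ n) : (A.inst (.var s n)).subst (bindVar s n) = A := by
  rw [Formula.inst, Formula.subst_subst]
  refine (Formula.subst_congr (fun s' m hm => ?_) hA).trans A.subst_var
  rw [Subst.inst_eq_cons, Subst.cons_comp]
  by_cases h : s' = s
  · subst h
    cases m with
    | zero => simp [Term.subst, bindVar]
    | succ m =>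
      have : m ≠ n := by omega
      simp [Subst.comp, Term.subst, bindVar, this, Subst.shift_same]
  · simp [Env.cons_of_ne h, Subst.comp, Term.subst, bindVar, h, Subst.shift_of_ne h]

theorem exists_fresh (s : L.Srt) (A B : Formula L) :
    ∃ n, (A.inst (.var s n)).subst (bindVar s n) = A ∧ B.subst (bindVar s n) = B.shift s := by
  obtain ⟨k, hk⟩ := A.exists_bounded
  obtain ⟨k', hk'⟩ := B.exists_bounded
  exact ⟨k s ⊔ k' s, inst_var_subst_bindVar hk le_sup_left, subst_bindVar hk' le_sup_right⟩

/-- The instance at a fresh variable is already generic. Hence the quantifier is the infimum of its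
instances in the preorder of propositions, although that preorder is not complete. -/
theorem Entails.all_iff {s : L.Srt} {A C : Formula L} :
    T.Entails C (.all s A) ↔ ∀ t : Term L s, T.Entails C (A.inst t) := by
  refine ⟨fun h t => .allE t (T.congr_refl _) (T.congr_refl _) h, fun h => ?_⟩
  obtain ⟨n, hA, hC⟩ := exists_fresh s A C
  have := (h (.var s n)).subst (bindVar s n)
  rw [hA, hC] at this
  refine .allI (T.congr_refl _) ?_
  rwa [Set.image_insert_eq, show Formula.shift s '' T.axioms = T.axioms from
    image_subst_axioms (Subst.shift s)]

theorem Entails.ex_iff {s : L.Srt} {A C : Formula L} :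
    T.Entails (.ex s A) C ↔ ∀ t : Term L s, T.Entails (A.inst t) C := by
  refine ⟨fun h t => trans (.exI t (T.congr_refl _) (T.congr_refl _) (refl _)) h, fun h => ?_⟩
  obtain ⟨n, hA, hC⟩ := exists_fresh s A C
  have := (h (.var s n)).subst (bindVar s n)
  rw [hA, hC] at this
  refine .exE (T.congr_refl _) (refl _) (this.mono ?_)
  rw [Set.image_insert_eq, show Formula.shift s '' T.axioms = T.axioms from
    image_subst_axioms (Subst.shift s)]
  exact Set.insert_subset_insert (Set.subset_insert _ _)

variable (T)

/-- The propositions, preordered by entailment. -/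
def Lind (_ : Theory L) : Type := Formula L

instance : Preorder T.Lind where
  le A B := T.Entails A B
  le_refl A := Entails.refl A
  le_trans _ _ _ h h' := Entails.trans h h'

/-- The lower bounds of the upper bounds, as a nucleus. -/
def nucleus : Nucleus (LowerSet T.Lind) where
  toFun U := ⟨{B | ∀ A, (∀ C ∈ U, C ≤ A) → B ≤ A}, fun _ _ h hB A hA => h.trans (hB A hA)⟩
  map_inf' U V := by
    refine SetLike.ext fun B => ⟨fun hB => And.intro
      (fun A hA => hB A fun C hC => hA C hC.1) (fun A hA => hB A fun C hC => hA C hC.2), ?_⟩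
    rintro ⟨hU, hV⟩ A hA
    -- For `C` in `U` and `D` in `V`, the conjunction lies in both, hence below `A`. So each `D ⇒ A`
    -- bounds `U` and is above `B`. Then `B ⇒ A` bounds `V`, and `B` is below `B ⇒ A`, thus below
    -- `A`. The existence of implications is what makes the completion a frame.
    have key : ∀ D ∈ V, T.Entails B (.imp D A) := fun D hD => hU _ fun C hC =>
      Entails.imp_iff.2 (hA (.and C D : Formula L)
        ⟨U.lower (show T.Entails _ _ from (Entails.and_iff.1 (Entails.refl _)).1) hC,
          V.lower (show T.Entails _ _ from (Entails.and_iff.1 (Entails.refl _)).2) hD⟩)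
    have : T.Entails B (.imp B A) := hV _ fun D hD => Entails.imp_iff.2
      (Entails.trans (Entails.and_iff.2 ⟨(Entails.and_iff.1 (Entails.refl _)).2,
        (Entails.and_iff.1 (Entails.refl _)).1⟩) (Entails.imp_iff.1 (key D hD)))
    exact Entails.trans (Entails.and_iff.2 ⟨Entails.refl _, Entails.refl _⟩)
      (Entails.imp_iff.1 this)
  idempotent' U := fun _ hB A hA => hB A fun _ hC => hC A hA
  le_apply' U := fun B hB _ hA => hA B hB

/-- The completion of the Lindenbaum algebra. -/
abbrev Val : Type := Set.range T.nucleus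

noncomputable instance : Order.Frame T.Val := inferInstance

/-- The value of a proposition in the completion. -/
def toVal (A : Formula L) : T.Val := T.nucleus.restrict (LowerSet.Iic (α := T.Lind) A)

variable {T}

theorem mem_toVal {A B : Formula L} : (B : T.Lind) ∈ (T.toVal A).1 ↔ T.Entails B A :=
  ⟨fun h => h A fun _ hC => hC, fun h _ hC => Entails.trans h (hC A (Entails.refl A))⟩

theorem toVal_le_iff_mem {A : Formula L} {X : T.Val} : T.toVal A ≤ X ↔ (A : T.Lind) ∈ X.1 :=
  ⟨fun h => h (mem_toVal.2 (Entails.refl A)), fun h _ hB => X.1.lower (mem_toVal.1 hB) h⟩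

theorem toVal_le_toVal {A B : Formula L} : T.toVal A ≤ T.toVal B ↔ T.Entails A B :=
  toVal_le_iff_mem.trans mem_toVal

/-- The values of propositions are join-dense in the completion, so existing infima are preserved.
-/
theorem le_of_forall_toVal {X Y : T.Val} (h : ∀ A, T.toVal A ≤ X → T.toVal A ≤ Y) : X ≤ Y :=
  fun A hA => toVal_le_iff_mem.1 (h A (toVal_le_iff_mem.2 hA))

/-- The values of propositions are also meet-dense, because a fixed point of the nucleus is
determined by its upper bounds. Hence existing suprema are preserved too, which lower sets alone
would not give for `∨` and `∃`. -/
theorem toVal_le_of_forall {A : Formula L} {X : T.Val}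
    (h : ∀ B, X ≤ T.toVal B → T.Entails A B) : T.toVal A ≤ X := by
  rw [toVal_le_iff_mem, ← Nucleus.mem_range.1 X.2]
  exact fun B hB => h B fun C hC => mem_toVal.2 (hB C hC)

theorem toVal_congr {A B : Formula L} (h : T.congr A B) (h' : T.congr B A) :
    T.toVal A = T.toVal B :=
  le_antisymm (toVal_le_toVal.2 (.of_congr h)) (toVal_le_toVal.2 (.of_congr h'))

theorem toVal_top : T.toVal .top = ⊤ :=
  top_le_iff.1 (le_of_forall_toVal fun _ _ => toVal_le_toVal.2 (.topI (T.congr_refl _)))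

theorem toVal_bot : T.toVal .bot = ⊥ :=
  le_bot_iff.1 (toVal_le_of_forall fun _ _ => .botE (T.congr_refl _) (Entails.refl _))

theorem toVal_and (A B : Formula L) : T.toVal (.and A B) = T.toVal A ⊓ T.toVal B := by
  refine le_antisymm (le_inf ?_ ?_) (le_of_forall_toVal fun C hC => ?_)
  · exact toVal_le_toVal.2 (Entails.and_iff.1 (Entails.refl _)).1
  · exact toVal_le_toVal.2 (Entails.and_iff.1 (Entails.refl _)).2
  · exact toVal_le_toVal.2 (Entails.and_iff.2
      ⟨toVal_le_toVal.1 (hC.trans inf_le_left), toVal_le_toVal.1 (hC.trans inf_le_right)⟩)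

theorem toVal_or (A B : Formula L) : T.toVal (.or A B) = T.toVal A ⊔ T.toVal B := by
  refine le_antisymm (toVal_le_of_forall fun C hC => ?_) (sup_le ?_ ?_)
  · exact Entails.or_iff.2
      ⟨toVal_le_toVal.1 (le_sup_left.trans hC), toVal_le_toVal.1 (le_sup_right.trans hC)⟩
  · exact toVal_le_toVal.2 (Entails.or_iff.1 (Entails.refl _)).1
  · exact toVal_le_toVal.2 (Entails.or_iff.1 (Entails.refl _)).2

theorem toVal_imp (A B : Formula L) : T.toVal (.imp A B) = T.toVal A ⇨ T.toVal B := by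
  refine le_antisymm ?_ (le_of_forall_toVal fun C hC => ?_)
  · rw [le_himp_iff, ← toVal_and, toVal_le_toVal]
    exact Entails.imp_iff.1 (Entails.refl _)
  · rw [le_himp_iff, ← toVal_and, toVal_le_toVal] at hC
    exact toVal_le_toVal.2 (Entails.imp_iff.2 hC)

theorem toVal_all (s : L.Srt) (A : Formula L) :
    T.toVal (.all s A) = ⨅ t : Term L s, T.toVal (A.inst t) := by
  refine le_antisymm (le_iInf fun t => ?_) (le_of_forall_toVal fun C hC => ?_)
  · exact toVal_le_toVal.2 (Entails.all_iff.1 (Entails.refl _) t)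
  · exact toVal_le_toVal.2 (Entails.all_iff.2 fun t =>
      toVal_le_toVal.1 (hC.trans (iInf_le _ t)))

theorem toVal_ex (s : L.Srt) (A : Formula L) :
    T.toVal (.ex s A) = ⨆ t : Term L s, T.toVal (A.inst t) := by
  refine le_antisymm (toVal_le_of_forall fun C hC => ?_) (iSup_le fun t => ?_)
  · exact Entails.ex_iff.2 fun t =>
      toVal_le_toVal.1 ((le_iSup (fun t : Term L s => T.toVal (A.inst t)) t).trans hC)
  · exact toVal_le_toVal.2 (Entails.ex_iff.1 (Entails.refl _) t)

theorem toVal_eq_top {A : Formula L} : T.toVal A = ⊤ ↔ T.Provable A := by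
  rw [← top_le_iff, ← toVal_top, toVal_le_toVal]
  refine ⟨fun h => ?_, fun h => h.mono (Set.subset_insert _ _)⟩
  exact .impE (T.congr_refl _) (.impI (T.congr_refl _) h) (.topI (T.congr_refl _))

end Theory

/-! ### Frame-valued models -/

/-- Existential elimination inside a frame: by distributivity `z` is covered by its parts `z ⊓ F i`,
and it suffices to argue on each part. -/
theorem le_of_le_iSup {H : Type} [Order.Frame H] {ι : Type} {F : ι → H} {z b : H}
    (hz : z ≤ ⨆ i, F i) (h : ∀ i, ∀ z' ≤ z, z' ≤ F i → z' ≤ b) : z ≤ b := by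
  rw [← inf_eq_left.2 hz, inf_iSup_eq]
  exact iSup_le fun i => h i _ inf_le_left inf_le_right

theorem le_of_le_sup {H : Type} [Order.Frame H] {x y z b : H}
    (hz : z ≤ x ⊔ y) (hx : ∀ z' ≤ z, z' ≤ x → z' ≤ b) (hy : ∀ z' ≤ z, z' ≤ y → z' ≤ b) :
    z ≤ b := by
  rw [← inf_eq_left.2 hz, inf_sup_left]
  exact sup_le (hx _ inf_le_left inf_le_right) (hy _ inf_le_left inf_le_right)

/-- A model with values in `H`; `ext s m` is the extent to which `m` exists. -/
structure Model (L : Signature) (H : Type) where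
  carrier : L.Srt → Type
  fn : (f : L.Fn) → ((i : Fin (L.fnAr f)) → carrier (L.fnDom f i)) → carrier (L.fnCod f)
  rel : (r : L.Rel) → ((i : Fin (L.relAr r)) → carrier (L.relDom r i)) → H
  ext : (s : L.Srt) → carrier s → H

namespace Model

variable {H : Type} (M : Model L H)

/-- The value of a term. -/
def eval (ρ : Env L M.carrier) : {s : L.Srt} → Term L s → M.carrier s
  | _, .var s n => ρ s n
  | _, .func f ts => M.fn f (fun i => eval ρ (ts i))

theorem eval_subst (σ : Subst L) (ρ : Env L M.carrier) {s : L.Srt} (t : Term L s) :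
    M.eval ρ (t.subst σ) = M.eval (fun s n => M.eval ρ (σ s n)) t := by
  induction t with
  | var s n => rfl
  | func f ts ih => simp only [Term.subst, eval, ih]

theorem eval_congr {k : L.Srt → ℕ} {ρ ρ' : Env L M.carrier}
    (h : ∀ s, ∀ n < k s, ρ s n = ρ' s n) {s : L.Srt} {t : Term L s} (ht : t.Bounded k) :
    M.eval ρ t = M.eval ρ' t := by
  induction t with
  | var s n => exact h s n ht
  | func f ts ih => simp only [eval, fun i => ih i (ht i)]

theorem eval_cons_shift (ρ : Env L M.carrier) {s : L.Srt} (m : M.carrier s) {s' : L.Srt}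
    (t : Term L s') : M.eval (Env.cons m ρ) (t.subst (Subst.shift s)) = M.eval ρ t := by
  rw [eval_subst]
  congr 1
  funext s'' n
  by_cases h : s'' = s
  · subst h; simp [Subst.shift_same, eval]
  · simp [Subst.shift_of_ne h, eval, Env.cons_of_ne h]

theorem eval_up (σ : Subst L) (ρ : Env L M.carrier) {s : L.Srt} (m : M.carrier s) :
    (fun s' n => M.eval (Env.cons m ρ) (Subst.up s σ s' n)) =
      Env.cons m (fun s n => M.eval ρ (σ s n)) := by
  rw [Subst.up_eq_cons]
  apply Env.eq_cons
  · simp [eval]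
  · intro n; simp [Subst.comp, eval_cons_shift]
  · intro s' n h; simp [Env.cons_of_ne h, Subst.comp, eval_cons_shift]

theorem eval_inst (ρ : Env L M.carrier) {s : L.Srt} (t : Term L s) :
    (fun s' n => M.eval ρ (Subst.inst t s' n)) = Env.cons (M.eval ρ t) ρ := by
  rw [Subst.inst_eq_cons]
  apply Env.eq_cons
  · simp
  · intro n; simp [eval]
  · intro s' n h; simp [Env.cons_of_ne h, eval]

variable [Order.Frame H]

/-- The value of a proposition. -/
def val : Env L M.carrier → Formula L → H
  | ρ, .rel r ts => M.rel r (fun i => M.eval ρ (ts i))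
  | _, .top => ⊤
  | _, .bot => ⊥
  | ρ, .and A B => val ρ A ⊓ val ρ B
  | ρ, .or A B => val ρ A ⊔ val ρ B
  | ρ, .imp A B => val ρ A ⇨ val ρ B
  | ρ, .all s A => ⨅ m : M.carrier s, M.ext s m ⇨ val (Env.cons m ρ) A
  | ρ, .ex s A => ⨆ m : M.carrier s, M.ext s m ⊓ val (Env.cons m ρ) A

theorem val_subst (σ : Subst L) (ρ : Env L M.carrier) (A : Formula L) :
    M.val ρ (A.subst σ) = M.val (fun s n => M.eval ρ (σ s n)) A := by
  induction A generalizing σ ρ with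
  | rel r ts => simp only [Formula.subst, val, eval_subst]
  | top => rfl
  | bot => rfl
  | and A B ihA ihB => simp only [Formula.subst, val, ihA, ihB]
  | or A B ihA ihB => simp only [Formula.subst, val, ihA, ihB]
  | imp A B ihA ihB => simp only [Formula.subst, val, ihA, ihB]
  | all s A ih => simp only [Formula.subst, val, ih, eval_up]
  | ex s A ih => simp only [Formula.subst, val, ih, eval_up]

theorem val_inst (ρ : Env L M.carrier) {s : L.Srt} (t : Term L s) (A : Formula L) :
    M.val ρ (A.inst t) = M.val (Env.cons (M.eval ρ t) ρ) A := by
  rw [Formula.inst, val_subst, eval_inst]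

theorem val_cons_shift (ρ : Env L M.carrier) {s : L.Srt} (m : M.carrier s) (A : Formula L) :
    M.val (Env.cons m ρ) (A.shift s) = M.val ρ A := by
  rw [Formula.shift, val_subst]
  exact congrArg (fun ρ => M.val ρ A)
    (funext fun s' => funext fun n => M.eval_cons_shift ρ m (.var s' n))

theorem val_congr {k : L.Srt → ℕ} {ρ ρ' : Env L M.carrier}
    (h : ∀ s, ∀ n < k s, ρ s n = ρ' s n) {A : Formula L} (hA : A.Bounded k) :
    M.val ρ A = M.val ρ' A := by
  induction A generalizing k ρ ρ' with
  | rel r ts => simp only [val, fun i => M.eval_congr h (hA i)]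
  | top => rfl
  | bot => rfl
  | and A B ihA ihB => simp only [val, ihA h hA.1, ihB h hA.2]
  | or A B ihA ihB => simp only [val, ihA h hA.1, ihB h hA.2]
  | imp A B ihA ihB => simp only [val, ihA h hA.1, ihB h hA.2]
  | all s A ih => simp only [val, fun m => ih (Env.cons_congr h m) hA]
  | ex s A ih => simp only [val, fun m => ih (Env.cons_congr h m) hA]

/-- All the values of the variables exist to the extent `z`. -/
def Within (z : H) (ρ : Env L M.carrier) : Prop := ∀ s n, z ≤ M.ext s (ρ s n)

variable {M}

theorem Within.cons {z : H} {ρ : Env L M.carrier} (hρ : M.Within z ρ) {s : L.Srt}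
    {m : M.carrier s} (hm : z ≤ M.ext s m) : M.Within z (Env.cons m ρ) := by
  intro s' n
  by_cases h : s' = s
  · subst h; cases n with
    | zero => simpa using hm
    | succ n => simpa using hρ _ n
  · simpa [Env.cons_of_ne h] using hρ _ n

theorem Within.mono {z z' : H} {ρ : Env L M.carrier} (hρ : M.Within z ρ) (h : z' ≤ z) :
    M.Within z' ρ := fun s n => h.trans (hρ s n)

theorem Within.le_ext_eval
    (hfn : ∀ (z : H) f ts, (∀ i, z ≤ M.ext _ (ts i)) → z ≤ M.ext _ (M.fn f ts))
    {z : H} {ρ : Env L M.carrier} (hρ : M.Within z ρ) {s : L.Srt} (t : Term L s) :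
    z ≤ M.ext s (M.eval ρ t) := by
  induction t with
  | var s n => exact hρ s n
  | func f ts ih => exact hfn z f _ ih

/-- Natural deduction modulo is sound for the models that validate the congruence. -/
theorem le_val_of_proves {E : Formula L → Formula L → Prop}
    (hfn : ∀ (z : H) f ts, (∀ i, z ≤ M.ext _ (ts i)) → z ≤ M.ext _ (M.fn f ts))
    (hE : ∀ A B ρ, E A B → M.val ρ A = M.val ρ B)
    {Γ : Set (Formula L)} {A : Formula L} (p : Proves E Γ A) {z : H} {ρ : Env L M.carrier}
    (hρ : M.Within z ρ) (hΓ : ∀ C ∈ Γ, z ≤ M.val ρ C) : z ≤ M.val ρ A := by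
  have ins : ∀ {A : Formula L} {Γ : Set (Formula L)} {z z' : H} {ρ : Env L M.carrier},
      (∀ C ∈ Γ, z ≤ M.val ρ C) → z' ≤ z → z' ≤ M.val ρ A →
      ∀ C ∈ insert A Γ, z' ≤ M.val ρ C := by
    rintro A Γ z z' ρ h hz hA C (rfl | hC)
    · exact hA
    · exact hz.trans (h C hC)
  have sh : ∀ {Γ : Set (Formula L)} {z z' : H} {ρ : Env L M.carrier} {s} (m : M.carrier s),
      (∀ C ∈ Γ, z ≤ M.val ρ C) → z' ≤ z →
      ∀ C ∈ Formula.shift s '' Γ, z' ≤ M.val (Env.cons m ρ) C := by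
    rintro Γ z z' ρ s m h hz _ ⟨C, hC, rfl⟩
    rw [val_cons_shift]
    exact hz.trans (h C hC)
  induction p generalizing z ρ with
  | ax hA h => exact hE _ _ ρ h ▸ hΓ _ hA
  | impI h _ ih =>
    rw [hE _ _ ρ h, val, le_himp_iff]
    exact ih (hρ.mono inf_le_left) (ins hΓ inf_le_left inf_le_right)
  | impE h _ _ ih ih' =>
    have h1 := ih hρ hΓ
    rw [hE _ _ ρ h, val, le_himp_iff] at h1
    exact (le_inf le_rfl (ih' hρ hΓ)).trans h1
  | andI h _ _ ih ih' =>
    rw [hE _ _ ρ h]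
    exact le_inf (ih hρ hΓ) (ih' hρ hΓ)
  | andE₁ h _ ih =>
    have h1 := ih hρ hΓ
    rw [hE _ _ ρ h] at h1
    exact h1.trans inf_le_left
  | andE₂ h _ ih =>
    have h1 := ih hρ hΓ
    rw [hE _ _ ρ h] at h1
    exact h1.trans inf_le_right
  | orI₁ h _ ih =>
    rw [hE _ _ ρ h]
    exact (ih hρ hΓ).trans le_sup_left
  | orI₂ h _ ih =>
    rw [hE _ _ ρ h]
    exact (ih hρ hΓ).trans le_sup_right
  | orE h _ _ _ ih ih' ih'' =>
    have h1 := ih hρ hΓ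
    rw [hE _ _ ρ h] at h1
    exact le_of_le_sup h1 (fun z' hz h2 => ih' (hρ.mono hz) (ins hΓ hz h2))
      (fun z' hz h2 => ih'' (hρ.mono hz) (ins hΓ hz h2))
  | topI h =>
    rw [hE _ _ ρ h]
    exact le_top
  | botE h _ ih =>
    have h1 := ih hρ hΓ
    rw [hE _ _ ρ h] at h1
    exact h1.trans bot_le
  | allI h _ ih =>
    rw [hE _ _ ρ h]
    refine le_iInf fun m => le_himp_iff.2 ?_
    -- The argument moves to the stage `z ⊓ ext m`, at which the new value exists.
    exact ih ((hρ.mono inf_le_left).cons inf_le_right) (sh m hΓ inf_le_left)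
  | allE t h h' _ ih =>
    have h1 := ih hρ hΓ
    rw [hE _ _ ρ h] at h1
    rw [hE _ _ ρ h', val_inst]
    exact (le_inf le_rfl (hρ.le_ext_eval hfn t)).trans
      (le_himp_iff.1 (h1.trans (iInf_le _ (M.eval ρ t))))
  | exI t h h' _ ih =>
    have h1 := ih hρ hΓ
    rw [hE _ _ ρ h', val_inst] at h1
    rw [hE _ _ ρ h]
    exact (le_inf (hρ.le_ext_eval hfn t) h1).trans
      (le_iSup (fun m => M.ext _ m ⊓ M.val (Env.cons m ρ) _) (M.eval ρ t))
  | exE h _ _ ih ih' =>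
    have h1 := ih hρ hΓ
    rw [hE _ _ ρ h] at h1
    refine le_of_le_iSup h1 fun m z' hz h2 => ?_
    have := ih' ((hρ.mono hz).cons (h2.trans inf_le_left))
      (ins (sh m hΓ hz) le_rfl (h2.trans inf_le_right))
    rwa [val_cons_shift] at this

end Model

/-- The terms, with values in the completed Lindenbaum algebra. -/
abbrev Theory.termModel (T : Theory L) : Model L T.Val where
  carrier := Term L
  fn := .func
  rel r ts := T.toVal (.rel r ts)
  ext _ _ := ⊤

namespace Theory

variable {T : Theory L}

theorem termModel_eval (σ : Subst L) {s : L.Srt} (t : Term L s) :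
    T.termModel.eval σ t = t.subst σ := by
  induction t with
  | var s n => rfl
  | func f ts ih => simp only [Model.eval, Term.subst, ih]

/-- The truth lemma: an environment of the term model is a substitution, and evaluation performs it.
-/
theorem termModel_val (σ : Subst L) (A : Formula L) :
    T.termModel.val σ A = T.toVal (A.subst σ) := by
  induction A generalizing σ with
  | rel r ts => simp only [Model.val, Formula.subst, termModel_eval]
  | top => exact toVal_top.symm
  | bot => exact toVal_bot.symm
  | and A B ihA ihB => simp only [Model.val, Formula.subst, toVal_and, ihA, ihB]
  | or A B ihA ihB => simp only [Model.val, Formula.subst, toVal_or, ihA, ihB]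
  | imp A B ihA ihB => simp only [Model.val, Formula.subst, toVal_imp, ihA, ihB]
  | all s A ih =>
    simp only [Model.val, Formula.subst, toVal_all, Formula.inst_subst_up]
    exact iInf_congr fun t => top_himp.trans (ih _)
  | ex s A ih =>
    simp only [Model.val, Formula.subst, toVal_ex, Formula.inst_subst_up]
    exact iSup_congr fun t => (top_inf_eq _).trans (ih _)

end Theory

/-! ### The two theories -/

namespace RewriteSystem

variable {R : RewriteSystem L}

theorem TermCongr.subst {s : L.Srt} {t u : Term L s} (h : R.TermCongr s t u) (σ : Subst L) :
    R.TermCongr s (t.subst σ) (u.subst σ) := by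
  induction h with
  | rule τ h => rw [Term.subst_subst, Term.subst_subst]; exact .rule _ h
  | refl t => exact .refl _
  | symm _ ih => exact .symm ih
  | trans _ _ ih ih' => exact .trans ih ih'
  | func f _ ih => exact .func f ih

theorem Congr.subst {A B : Formula L} (h : R.Congr A B) (σ : Subst L) :
    R.Congr (A.subst σ) (B.subst σ) := by
  induction h generalizing σ with
  | rule τ h => rw [Formula.subst_subst, Formula.subst_subst]; exact .rule _ h
  | refl t => exact .refl _
  | symm _ ih => exact .symm (ih σ)
  | trans _ _ ih ih' => exact .trans (ih σ) (ih' σ)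
  | rel r h => exact .rel r fun i => (h i).subst σ
  | and _ _ ih ih' => exact .and (ih σ) (ih' σ)
  | or _ _ ih ih' => exact .or (ih σ) (ih' σ)
  | imp _ _ ih ih' => exact .imp (ih σ) (ih' σ)
  | all s _ ih => exact .all s (ih _)
  | ex s _ ih => exact .ex s (ih _)

/-- Deduction modulo the congruence of `R`, without axioms. -/
def theory (R : RewriteSystem L) : Theory L where
  congr := R.Congr
  axioms := ∅
  congr_refl := .refl
  congr_subst σ _ _ h := h.subst σ
  axioms_subst _ h := h.elim

theorem toVal_congr {A B : Formula L} (h : R.Congr A B) : R.theory.toVal A = R.theory.toVal B :=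
  Theory.toVal_congr (T := R.theory) h h.symm

theorem termModel_val_rule {l r : Formula L} (h : R.propRule l r) (σ : Subst L) :
    R.theory.termModel.val σ l = R.theory.termModel.val σ r := by
  rw [Theory.termModel_val, Theory.termModel_val]
  exact toVal_congr (.rule σ h)

/-- The models that validate the term rules and the proposition rules validate the
congruence. -/
theorem Congr.val_eq {H : Type} [Order.Frame H] {M : Model L H}
    (ht : ∀ s l r ρ, R.termRule s l r → M.eval ρ l = M.eval ρ r)
    (hp : ∀ l r ρ, R.propRule l r → M.val ρ l = M.val ρ r)
    {A B : Formula L} (h : R.Congr A B) (ρ : Env L M.carrier) : M.val ρ A = M.val ρ B := by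
  have term : ∀ {s} {t u : Term L s}, R.TermCongr s t u →
      ∀ ρ : Env L M.carrier, M.eval ρ t = M.eval ρ u := by
    intro s t u h
    induction h with
    | rule σ h => intro ρ; rw [Model.eval_subst, Model.eval_subst, ht _ _ _ _ h]
    | refl t => exact fun ρ => rfl
    | symm _ ih => exact fun ρ => (ih ρ).symm
    | trans _ _ ih ih' => exact fun ρ => (ih ρ).trans (ih' ρ)
    | func f _ ih => exact fun ρ => by simp only [Model.eval, fun i => ih i ρ]
  induction h generalizing ρ with
  | rule σ h => rw [Model.val_subst, Model.val_subst, hp _ _ _ h]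
  | refl t => rfl
  | symm _ ih => exact (ih ρ).symm
  | trans _ _ ih ih' => exact (ih ρ).trans (ih' ρ)
  | rel r h => simp only [Model.val, fun i => term (h i) ρ]
  | and _ _ ih ih' => simp only [Model.val, ih, ih']
  | or _ _ ih ih' => simp only [Model.val, ih, ih']
  | imp _ _ ih ih' => simp only [Model.val, ih, ih']
  | all s _ ih => simp only [Model.val, ih]
  | ex s _ ih => simp only [Model.val, ih]

end RewriteSystem

theorem comp_fin_two {α β : Type} (g : α → β) (x y : α) :
    (fun i => g ((![x, y] : Fin 2 → α) i)) = ![g x, g y] := by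
  funext i; fin_cases i <;> rfl

theorem eq_fin_two {α : Type} (f : Fin 2 → α) : f = ![f 0, f 1] := by
  funext i; fin_cases i <;> rfl

/-! ### Models of the language of arithmetic -/

namespace HA

variable {H : Type} (M : Model lang H)

/-- The elements of the model. -/
abbrev Dom : Type := M.carrier ()

/-- The interpretation of `0`. -/
def mzero : Dom M := M.fn Fn.zero (fun i => Fin.elim0 i)

/-- The interpretation of `S`. -/
def msucc (a : Dom M) : Dom M := M.fn Fn.succ (fun _ => a)

/-- The interpretation of `+`. -/
def madd (a b : Dom M) : Dom M := M.fn Fn.add (![a, b] : Fin 2 → Dom M)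

/-- The interpretation of `×`. -/
def mmul (a b : Dom M) : Dom M := M.fn Fn.mul (![a, b] : Fin 2 → Dom M)

/-- The interpretation of `=`. -/
def meq (a b : Dom M) : H := M.rel () (![a, b] : Fin 2 → Dom M)

@[simp] theorem eval_var (ρ : Env lang M.carrier) (n : ℕ) : M.eval ρ (var n) = ρ () n := rfl

@[simp] theorem eval_zero (ρ : Env lang M.carrier) : M.eval ρ zero = mzero M := by
  simp only [zero, Model.eval, mzero]
  congr 1
  funext i
  exact Fin.elim0 i

@[simp] theorem eval_succ (ρ : Env lang M.carrier) (t : Tm) :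
    M.eval ρ (succ t) = msucc M (M.eval ρ t) := rfl

@[simp] theorem eval_add (ρ : Env lang M.carrier) (t u : Tm) :
    M.eval ρ (add t u) = madd M (M.eval ρ t) (M.eval ρ u) :=
  congrArg (M.fn Fn.add) (comp_fin_two (M.eval ρ (s := ())) t u)

@[simp] theorem eval_mul (ρ : Env lang M.carrier) (t u : Tm) :
    M.eval ρ (mul t u) = mmul M (M.eval ρ t) (M.eval ρ u) :=
  congrArg (M.fn Fn.mul) (comp_fin_two (M.eval ρ (s := ())) t u)

theorem eval_succSubst (ρ : Env lang M.carrier) (a : Dom M) :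
    (fun s n => M.eval (Env.cons (L := lang) (s := ()) a ρ) (succSubst s n)) =
      Env.cons (L := lang) (s := ()) (msucc M a) ρ := by
  apply Env.eq_cons
  · simp [succSubst]
  · intro n; simp [succSubst]
  · exact fun s' n h => absurd rfl h

variable [Order.Frame H]

@[simp] theorem val_eq (ρ : Env lang M.carrier) (t u : Tm) :
    M.val ρ (eq t u) = meq M (M.eval ρ t) (M.eval ρ u) :=
  congrArg (M.rel ()) (comp_fin_two (M.eval ρ (s := ())) t u)

/-- Closed axioms are fixed by substitution, as a `Theory` demands; for induction this is the role
of the universal closure over the parameters. -/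
theorem Axiom.closed {A : Fm} (h : Axiom A) : A.Closed := by
  have two : ∀ {p : Fin 2 → Prop}, p 0 → p 1 → ∀ i, p i := by
    intro p h0 h1 i; fin_cases i; exacts [h0, h1]
  induction h with
  | induct n P hP =>
    refine Formula.Bounded.allN n ?_
    have hk : ∀ m : ℕ, (Function.update (fun _ : Unit => 0) () m) = fun _ => m :=
      fun m => funext fun _ => by simp
    rw [Nat.zero_add, hk]
    have h1 : Function.update (fun _ : Unit => n) () (n + 1) = fun _ => n + 1 :=
      funext fun _ => by simp
    refine ⟨hP.subst fun s i hi => ?_, ?_, ?_⟩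
    · rw [Subst.inst_eq_cons]
      cases i with
      | zero => rw [Env.cons_zero]; exact fun i => Fin.elim0 i
      | succ i => rw [Env.cons_succ]; exact Nat.lt_of_succ_lt_succ hi
    · show Formula.Bounded (L := lang) (Function.update (fun _ : Unit => n) () (n + 1)) _
      rw [h1]
      refine ⟨hP, hP.subst fun s i hi => ?_⟩
      cases i with
      | zero => exact fun _ => Nat.succ_pos n
      | succ i => exact hi
    · show Formula.Bounded (L := lang) (Function.update (fun _ : Unit => n) () (n + 1)) _
      rw [h1]
      exact hP
  | _ => 
    simp [Formula.Closed, Formula.Bounded, eq, Term.Bounded, succ, add, mul, var, zero,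
      Formula.neg, Fin.forall_fin_two]

/-- Heyting arithmetic. -/
def theory : Theory lang where
  congr := fun A B => A = B
  axioms := Axiom
  congr_refl _ := rfl
  congr_subst _ _ _ h := congrArg _ h
  axioms_subst _ h := (Axiom.closed h).subst_eq

end HA

/-! ### Relativization and the embeddings between the three languages -/

namespace HAN

/-- Heyting arithmetic relativized to `N`. -/
abbrev relativize {H : Type} (K : Model lang H) : Model HA.lang H where
  carrier _ := K.carrier ()
  fn f := K.fn (.ha f)
  rel _ := K.rel .eq
  ext _ m := K.rel .nat (fun _ => m)

variable {H : Type} (K : Model lang H)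

theorem eval_ofHATerm (ρ : Env lang K.carrier) {s : HA.lang.Srt} (t : Term HA.lang s) :
    K.eval ρ (ofHATerm t) = (relativize K).eval (fun _ => ρ ()) t := by
  induction t with
  | var s n => rfl
  | func f ts ih => exact congrArg (K.fn (.ha f)) (funext ih)

theorem cons_eq {M : Unit → Type} (m : M ()) (ρ : Env lang M) :
    (fun _ : Unit => Env.cons (L := lang) (s := ()) m ρ ()) =
      Env.cons (L := HA.lang) (M := fun _ => M ()) (s := ()) m (fun _ => ρ ()) := by
  apply Env.eq_cons (L := HA.lang) (M := fun _ => M ()) (s := ())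
  · simp
  · intro n; simp
  · exact fun s' n h => absurd rfl h

/-- The guards `N(x)` written by the translation are the extents by which `relativize` bounds its
quantifiers; by `hK` the quantifiers of `K` add no other bound. -/
theorem val_translate [Order.Frame H] (hK : ∀ s m, K.ext s m = ⊤) (ρ : Env lang K.carrier)
    (A : HA.Fm) : K.val ρ (translate A) = (relativize K).val (fun _ => ρ ()) A := by
  induction A generalizing ρ with
  | rel r ts => exact congrArg (K.rel .eq) (funext fun i => eval_ofHATerm K ρ (ts i))
  | top => rfl
  | bot => rfl
  | and A B ihA ihB => simp only [translate, Model.val, ihA, ihB]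
  | or A B ihA ihB => simp only [translate, Model.val, ihA, ihB]
  | imp A B ihA ihB => simp only [translate, Model.val, ihA, ihB]
  | all s A ih =>
    refine iInf_congr fun m => ?_
    simp only [hK, top_himp, Model.val, ih, cons_eq]
    simp [nat, var, Model.val, Model.eval, relativize]
  | ex s A ih =>
    refine iSup_congr fun m => ?_
    simp only [hK, top_inf_eq, Model.val, ih, cons_eq]
    simp [nat, var, Model.val, Model.eval, relativize]

end HAN

namespace HAModulo

/-- The numbers of a model. -/
abbrev numbers {H : Type} (M : Model lang H) : Model HAN.lang H where
  carrier _ := M.carrier Srt.num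
  fn f := M.fn (.arith f)
  rel r := M.rel (.arith r)
  ext _ := M.ext Srt.num

variable {H : Type} (M : Model lang H)

theorem eval_ofHANTerm (ρ : Env lang M.carrier) {s : HAN.lang.Srt} (t : Term HAN.lang s) :
    M.eval ρ (ofHANTerm t) = (numbers M).eval (fun _ => ρ Srt.num) t := by
  induction t with
  | var s n => rfl
  | func f ts ih => exact congrArg (M.fn (.arith f)) (funext ih)

theorem cons_eq {M : Srt → Type} (m : M Srt.num) (ρ : Env lang M) :
    (fun _ : Unit => Env.cons (L := lang) (s := Srt.num) m ρ Srt.num) =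
      Env.cons (L := HAN.lang) (M := fun _ => M Srt.num) (s := ()) m (fun _ => ρ Srt.num) := by
  apply Env.eq_cons (L := HAN.lang) (M := fun _ => M Srt.num) (s := ())
  · simp
  · intro n; simp
  · exact fun s' n h => absurd rfl h

theorem val_ofHAN [Order.Frame H] (ρ : Env lang M.carrier) (A : HAN.Fm) :
    M.val ρ (ofHAN A) = (numbers M).val (fun _ => ρ Srt.num) A := by
  induction A generalizing ρ with
  | rel r ts => exact congrArg (M.rel (.arith r)) (funext fun i => eval_ofHANTerm M ρ (ts i))
  | top => rfl
  | bot => rfl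
  | and A B ihA ihB => simp only [ofHAN, Model.val, ihA, ihB]
  | or A B ihA ihB => simp only [ofHAN, Model.val, ihA, ihB]
  | imp A B ihA ihB => simp only [ofHAN, Model.val, ihA, ihB]
  | all s A ih => simp only [ofHAN, Model.val, ih, cons_eq]
  | ex s A ih => simp only [ofHAN, Model.val, ih, cons_eq]

end HAModulo

namespace HAModulo

/-! ### Arithmetic in the theory modulo -/

theorem term_zero_eq (ts : Fin 0 → NumTm) :
    Term.func (L := lang) (Fn.arith (.ha .zero)) ts = zero := by
  simp only [zero]
  congr 1
  funext i
  exact Fin.elim0 i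

theorem subst_zero (σ : Subst lang) : zero.subst σ = zero := term_zero_eq _

theorem subst_add (σ : Subst lang) (t u : NumTm) :
    (add t u).subst σ = add (t.subst σ) (u.subst σ) :=
  congrArg (Term.func (L := lang) (Fn.arith (.ha .add))) (comp_fin_two (Term.subst σ) t u)

theorem subst_mul (σ : Subst lang) (t u : NumTm) :
    (mul t u).subst σ = mul (t.subst σ) (u.subst σ) :=
  congrArg (Term.func (L := lang) (Fn.arith (.ha .mul))) (comp_fin_two (Term.subst σ) t u)

/-- The substitution of `t` and `u` for the number variables `1` and `0`. -/
def subst₂ (t u : NumTm) : Subst lang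
  | .num, 0 => u
  | .num, _ => t
  | .cls, n => cvar n

theorem congr_pred_succ (t : NumTm) : rules.TermCongr Srt.num (pred (succ t)) t :=
  RewriteSystem.TermCongr.rule (R := rules) (subst₂ t t) TermRule.pred_succ

theorem congr_zero_add (t : NumTm) : rules.TermCongr Srt.num (add zero t) t := by
  have := RewriteSystem.TermCongr.rule (R := rules) (subst₂ t t) TermRule.zero_add
  rwa [subst_add, subst_zero] at this

theorem congr_succ_add (t u : NumTm) :
    rules.TermCongr Srt.num (add (succ t) u) (succ (add t u)) := by
  have := RewriteSystem.TermCongr.rule (R := rules) (subst₂ t u) TermRule.succ_add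
  rwa [subst_add, show (succ (add (nvar 1) (nvar 0))).subst (subst₂ t u) =
    succ ((add (nvar 1) (nvar 0)).subst _) from rfl, subst_add] at this

theorem congr_zero_mul (t : NumTm) : rules.TermCongr Srt.num (mul zero t) zero := by
  have := RewriteSystem.TermCongr.rule (R := rules) (subst₂ t t) TermRule.zero_mul
  rwa [subst_mul, subst_zero] at this

theorem congr_succ_mul (t u : NumTm) :
    rules.TermCongr Srt.num (mul (succ t) u) (add (mul t u) u) := by
  have := RewriteSystem.TermCongr.rule (R := rules) (subst₂ t u) TermRule.succ_mul
  rwa [subst_mul, subst_add, subst_mul] at this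

/-- The term model of the theory modulo. -/
abbrev tm : Model lang rules.theory.Val := rules.theory.termModel

/-- The values of the propositions of the theory modulo. -/
abbrev V : Type := rules.theory.Val

/-- The value of `t = u`. -/
noncomputable def vEq (t u : NumTm) : V := rules.theory.toVal (eq t u)

/-- The value of `N(t)`. -/
noncomputable def vNat (t : NumTm) : V := rules.theory.toVal (nat t)

/-- The value of `Null(t)`. -/
noncomputable def vNull (t : NumTm) : V := rules.theory.toVal (null t)

/-- The value of `t ∈ c`. -/
noncomputable def vMem (t : NumTm) (c : ClsTm) : V := rules.theory.toVal (mem t c)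

theorem vEq_congr {t t' u u' : NumTm} (h : rules.TermCongr Srt.num t t')
    (h' : rules.TermCongr Srt.num u u') : vEq t u = vEq t' u' :=
  RewriteSystem.toVal_congr (R := rules) (.rel (L := lang) (Rel.arith .eq) fun i => by
    match i with
    | 0 => exact h
    | 1 => exact h')

theorem vNat_congr {t t' : NumTm} (h : rules.TermCongr Srt.num t t') : vNat t = vNat t' :=
  RewriteSystem.toVal_congr (R := rules) (.rel (L := lang) (Rel.arith .nat) fun _ => h)

theorem val_mem (σ : Subst lang) (t : NumTm) (c : ClsTm) :
    tm.val σ (mem t c) = vMem (t.subst σ) (c.subst σ) := by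
  rw [Theory.termModel_val]
  refine congrArg (fun ts => rules.theory.toVal (Formula.rel (L := lang) Rel.mem ts))
    (funext fun i => ?_)
  match i with
  | 0 => rfl
  | 1 => rfl

theorem val_eq (σ : Subst lang) (t u : NumTm) :
    tm.val σ (eq t u) = vEq (t.subst σ) (u.subst σ) := by
  rw [Theory.termModel_val]
  exact congrArg (fun ts => rules.theory.toVal (Formula.rel (L := lang) (Rel.arith .eq) ts))
    (comp_fin_two (Term.subst σ) t u)

theorem val_nat (σ : Subst lang) (t : NumTm) : tm.val σ (nat t) = vNat (t.subst σ) :=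
  Theory.termModel_val _ _

theorem val_null (σ : Subst lang) (t : NumTm) : tm.val σ (null t) = vNull (t.subst σ) :=
  Theory.termModel_val _ _

/-- Congruent propositions have equal values, so each rewrite rule becomes an identity in the frame,
with the quantifier over classes ranging over class terms. -/
theorem vEq_eq (t u : NumTm) : vEq t u = ⨅ c : ClsTm, vMem t c ⇨ vMem u c := by
  have h := RewriteSystem.termModel_val_rule (R := rules) PropRule.eq (subst₂ t u)
  rw [val_eq] at h
  refine h.trans (iInf_congr fun c => ?_)
  refine (top_himp).trans ?_
  rw [Model.val, val_mem, val_mem]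
  rfl

theorem vNat_eq (t : NumTm) : vNat t = ⨅ c : ClsTm, vMem zero c ⇨
    (⨅ u : NumTm, vNat u ⇨ vMem u c ⇨ vMem (succ u) c) ⇨ vMem t c := by
  have h := RewriteSystem.termModel_val_rule (R := rules) PropRule.nat (subst₂ t t)
  rw [val_nat] at h
  refine h.trans (iInf_congr fun c => (top_himp).trans ?_)
  rw [Model.val, Model.val, val_mem, val_mem, subst_zero]
  refine congrArg₂ _ rfl (congrArg₂ _ (iInf_congr fun u => (top_himp).trans ?_) rfl)
  rw [Model.val, Model.val, val_nat, val_mem, val_mem]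
  rfl

theorem vNull_zero : vNull zero = ⊤ := by
  have h := RewriteSystem.termModel_val_rule (R := rules) PropRule.null_zero (subst₂ zero zero)
  rwa [val_null, subst_zero] at h

theorem vNull_succ (t : NumTm) : vNull (succ t) = ⊥ := by
  have h := RewriteSystem.termModel_val_rule (R := rules) PropRule.null_succ (subst₂ t t)
  rwa [val_null] at h

/-- The value of a one-sorted proposition. -/
noncomputable def hval (σ : ℕ → NumTm) (P : HAN.Fm) : V := (numbers tm).val (fun _ => σ) P

/-- Insert a value for the variable with index `0`. -/
def scons {α : Type} (a : α) (σ : ℕ → α) : ℕ → α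
  | 0 => a
  | n + 1 => σ n

theorem comprehension (σ : ℕ → NumTm) (P : HAN.Fm) :
    ∃ c : ClsTm, ∀ t, vMem t c = hval (scons t σ) P := by
  obtain ⟨k, hk⟩ := P.exists_bounded
  -- Index `0` is the member, and the `k ()` further indices are the arguments of the comprehension
  -- symbol.
  have hP : P.Bounded (fun _ => k () + 1) := hk.mono fun _ => Nat.le_succ _
  refine ⟨comp (k ()) P hP fun i => σ i, fun t => ?_⟩
  have h := RewriteSystem.termModel_val_rule (R := rules) (PropRule.comp (k ()) P hP)
    (fun s n => match s with
      | .num => scons t σ n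
      | .cls => cvar n)
  rw [val_mem, val_ofHAN] at h
  exact h

theorem le_hval_of_le_vEq (P : HAN.Fm) (σ : ℕ → NumTm) {t u : NumTm} {z : V}
    (h : z ≤ vEq t u) (ht : z ≤ hval (scons t σ) P) : z ≤ hval (scons u σ) P := by
  obtain ⟨c, hc⟩ := comprehension σ P
  rw [vEq_eq] at h
  rw [← hc] at ht ⊢
  exact (le_inf le_rfl ht).trans (le_himp_iff.1 (h.trans (iInf_le _ c)))

/-- Induction comes from the impredicative rule for `N` at the class of `P`. The premise `N(y)` in
that rule is what lets the step assume that `u` is a natural number. -/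
theorem le_hval_of_le_vNat (P : HAN.Fm) (σ : ℕ → NumTm) {t : NumTm} {z : V} (h : z ≤ vNat t)
    (h0 : z ≤ hval (scons zero σ) P)
    (hs : ∀ u, ∀ z' ≤ z, z' ≤ vNat u → z' ≤ hval (scons u σ) P →
      z' ≤ hval (scons (succ u) σ) P) : z ≤ hval (scons t σ) P := by
  obtain ⟨c, hc⟩ := comprehension σ P
  rw [vNat_eq] at h
  simp only [← hc] at *
  have h1 := (le_inf le_rfl h0).trans (le_himp_iff.1 (h.trans (iInf_le _ c)))
  refine (le_inf le_rfl (le_iInf fun u => le_himp_iff.2 (le_himp_iff.2 ?_))).trans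
    (le_himp_iff.1 h1)
  exact hs u _ (inf_le_left.trans inf_le_left) (inf_le_left.trans inf_le_right) inf_le_right

theorem vEq_refl (t : NumTm) : vEq t t = ⊤ := by simp [vEq_eq]

theorem vNat_zero : vNat zero = ⊤ := by
  rw [vNat_eq, iInf_eq_top]
  intro c
  rw [himp_eq_top_iff, le_himp_iff]
  exact inf_le_left

theorem vNat_succ (t : NumTm) : vNat t ≤ vNat (succ t) := by
  rw [vNat_eq (succ t)]
  refine le_iInf fun c => le_himp_iff.2 (le_himp_iff.2 ?_)
  have h1 : vNat t ≤ _ := (vNat_eq t).le.trans (iInf_le _ c)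
  have h2 : vNat t ⊓ vMem zero c ⊓
      (⨅ u : NumTm, vNat u ⇨ vMem u c ⇨ vMem (succ u) c) ≤ vMem t c :=
    le_himp_iff.1 (le_himp_iff.1 h1)
  refine (le_inf (le_inf inf_le_right (inf_le_left.trans inf_le_left)) h2).trans ?_
  exact le_himp_iff.1 (le_himp_iff.1 (iInf_le _ t))

/-- The numbers of the theory modulo, as a model of the language of HA. -/
abbrev naturals : Model HA.lang V := HAN.relativize (numbers tm)

theorem hval_translate (σ : ℕ → NumTm) (A : HA.Fm) :
    hval σ (HAN.translate A) = naturals.val (fun _ => σ) A :=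
  HAN.val_translate _ (fun _ _ => rfl) _ _

theorem scons_eq_cons (t : NumTm) (ρ : Env HA.lang naturals.carrier) :
    (fun _ => scons t (ρ ()) : Env HA.lang naturals.carrier) =
      Env.cons (L := HA.lang) (s := ()) t ρ := by
  apply Env.eq_cons
  · rfl
  · intro n; rfl
  · exact fun s' n h => absurd rfl h

@[simp] theorem mzero_naturals : HA.mzero naturals = zero := term_zero_eq _

@[simp] theorem msucc_naturals (t : NumTm) : HA.msucc naturals t = succ t := rfl

@[simp] theorem madd_naturals (t u : NumTm) : HA.madd naturals t u = add t u := rfl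

@[simp] theorem mmul_naturals (t u : NumTm) : HA.mmul naturals t u = mul t u := rfl

@[simp] theorem meq_naturals (t u : NumTm) : HA.meq naturals t u = vEq t u := rfl

/-- Comprehension is available for one-sorted propositions, so `P` is passed through its
translation. The equality laws below are instances of this replacement, starting from a reflexive or
given equation. -/
theorem le_val_of_le_vEq (P : HA.Fm) (σ : ℕ → NumTm) {t u : NumTm} {z : V}
    (h : z ≤ vEq t u) (ht : z ≤ naturals.val (fun _ => scons t σ) P) :
    z ≤ naturals.val (fun _ => scons u σ) P := by
  exact (le_hval_of_le_vEq _ σ h (ht.trans (hval_translate (scons t σ) P).ge)).trans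
    (hval_translate (scons u σ) P).le

theorem vEq_symm {z : V} {t u : NumTm} (h : z ≤ vEq t u) : z ≤ vEq u t := by
  simpa [scons] using le_val_of_le_vEq (HA.eq (HA.var 0) (HA.var 1)) (scons t fun _ => t) h
    (by simp [scons, vEq_refl])

theorem vEq_trans {z : V} {t u v : NumTm} (h : z ≤ vEq t u) (h' : z ≤ vEq u v) :
    z ≤ vEq t v := by
  simpa [scons] using le_val_of_le_vEq (HA.eq (HA.var 1) (HA.var 0)) (scons t fun _ => t) h'
    (by simpa [scons] using h)

theorem vEq_succ {z : V} {t u : NumTm} (h : z ≤ vEq t u) : z ≤ vEq (succ t) (succ u) := by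
  simpa [scons] using le_val_of_le_vEq (HA.eq (HA.succ (HA.var 1)) (HA.succ (HA.var 0)))
    (scons t fun _ => t) h (by simp [scons, vEq_refl])

theorem vEq_add {z : V} {t t' u u' : NumTm} (h : z ≤ vEq t t') (h' : z ≤ vEq u u') :
    z ≤ vEq (add t u) (add t' u') := by
  have h1 : z ≤ vEq (add t u) (add t' u) := by
    simpa [scons] using le_val_of_le_vEq
      (HA.eq (HA.add (HA.var 1) (HA.var 2)) (HA.add (HA.var 0) (HA.var 2)))
      (scons t fun _ => u) h (by simp [scons, vEq_refl])
  have h2 : z ≤ vEq (add t' u) (add t' u') := by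
    simpa [scons] using le_val_of_le_vEq
      (HA.eq (HA.add (HA.var 1) (HA.var 2)) (HA.add (HA.var 1) (HA.var 0)))
      (scons t' fun _ => u) h' (by simp [scons, vEq_refl])
  exact vEq_trans h1 h2

theorem vEq_mul {z : V} {t t' u u' : NumTm} (h : z ≤ vEq t t') (h' : z ≤ vEq u u') :
    z ≤ vEq (mul t u) (mul t' u') := by
  have h1 : z ≤ vEq (mul t u) (mul t' u) := by
    simpa [scons] using le_val_of_le_vEq
      (HA.eq (HA.mul (HA.var 1) (HA.var 2)) (HA.mul (HA.var 0) (HA.var 2)))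
      (scons t fun _ => u) h (by simp [scons, vEq_refl])
  have h2 : z ≤ vEq (mul t' u) (mul t' u') := by
    simpa [scons] using le_val_of_le_vEq
      (HA.eq (HA.mul (HA.var 1) (HA.var 2)) (HA.mul (HA.var 1) (HA.var 0)))
      (scons t' fun _ => u) h' (by simp [scons, vEq_refl])
  exact vEq_trans h1 h2

/-- Replace `S(t)` by `S(u)` in the predicate `t = Pred(x)`. -/
theorem vEq_of_succ {z : V} {t u : NumTm} (h : z ≤ vEq (succ t) (succ u)) : z ≤ vEq t u := by
  have key : ∀ v, hval (scons v fun _ => t) (Formula.rel (L := HAN.lang) HAN.Rel.eq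
      (![HAN.var 1, Term.func (L := HAN.lang) HAN.Fn.pred fun _ => HAN.var 0] :
        Fin 2 → HAN.Tm)) = vEq t (pred v) := fun v =>
    congrArg (fun ts => rules.theory.toVal (Formula.rel (L := lang) (Rel.arith .eq) ts))
      (comp_fin_two ((numbers tm).eval (s := ()) _) _ _)
  have := le_hval_of_le_vEq _ _ h
    (by rw [key, vEq_congr (.refl _) (congr_pred_succ t), vEq_refl]; exact le_top)
  rwa [key, vEq_congr (.refl _) (congr_pred_succ u)] at this

/-- `Null` holds of `0` and fails of `S(t)`, so Leibniz equality of the two yields absurdity. -/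
theorem vEq_zero_succ (t : NumTm) : vEq zero (succ t) = ⊥ := by
  have := le_hval_of_le_vEq (Formula.rel (L := HAN.lang) HAN.Rel.null fun _ => HAN.var 0)
    (fun _ => t) (le_refl (vEq zero (succ t))) (le_top.trans vNull_zero.ge)
  exact le_bot_iff.1 (this.trans (vNull_succ t).le)

/-- Induction on the first argument, where the rewrite rules recurse. `N` may occur in
comprehension, so "`x + u` is in `N`" is an admissible induction predicate. -/
theorem vNat_add {z : V} {t u : NumTm} (ht : z ≤ vNat t) (hu : z ≤ vNat u) :
    z ≤ vNat (add t u) := by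
  have key : ∀ v, hval (scons v fun _ => u)
      (HAN.nat (HAN.ofHATerm (HA.add (HA.var 0) (HA.var 1)))) = vNat (add v u) := fun v =>
    congrArg vNat ((HAN.eval_ofHATerm (numbers tm) (fun _ => scons v fun _ => u)
      (HA.add (HA.var 0) (HA.var 1))).trans (HA.eval_add naturals _ _ _))
  have := le_hval_of_le_vNat _ (fun _ => u) ht
    (by rw [key, vNat_congr (congr_zero_add u)]; exact hu)
    (fun v z' _ _ h => by
      rw [key] at h ⊢
      rw [vNat_congr (congr_succ_add v u)]
      exact h.trans (vNat_succ _))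
  rwa [key] at this

theorem vNat_mul {z : V} {t u : NumTm} (ht : z ≤ vNat t) (hu : z ≤ vNat u) :
    z ≤ vNat (mul t u) := by
  have key : ∀ v, hval (scons v fun _ => u)
      (HAN.nat (HAN.ofHATerm (HA.mul (HA.var 0) (HA.var 1)))) = vNat (mul v u) := fun v =>
    congrArg vNat ((HAN.eval_ofHATerm (numbers tm) (fun _ => scons v fun _ => u)
      (HA.mul (HA.var 0) (HA.var 1))).trans (HA.eval_mul naturals _ _ _))
  have := le_hval_of_le_vNat _ (fun _ => u) ht
    (by rw [key, vNat_congr (congr_zero_mul u), vNat_zero]; exact le_top)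
    (fun v z' hz _ h => by
      rw [key] at h ⊢
      rw [vNat_congr (congr_succ_mul v u)]
      exact vNat_add h (hz.trans hu))
  rwa [key] at this

/-- The closure of extents under the operations that soundness requires of `naturals`. -/
theorem le_vNat_func {z : V} (f : HA.Fn) (ts : Fin (HA.arity f) → NumTm)
    (h : ∀ i, z ≤ vNat (ts i)) :
    z ≤ vNat (Term.func (L := lang) (Fn.arith (.ha f)) ts) := by
  cases f with
  | zero => rw [term_zero_eq, vNat_zero]; exact le_top
  | succ =>
    rw [show ts = fun _ => ts 0 from funext fun i => congrArg ts (Subsingleton.elim i 0)]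
    exact (h 0).trans (vNat_succ _)
  | add => rw [eq_fin_two ts]; exact vNat_add (h 0) (h 1)
  | mul => rw [eq_fin_two ts]; exact vNat_mul (h 0) (h 1)

end HAModulo

/-! ### Validity of the axioms of HA in the numbers of the theory modulo -/

theorem Model.val_all_eq_top {L : Signature} {H : Type} [Order.Frame H] {M : Model L H}
    {ρ : Env L M.carrier} {s : L.Srt} {A : Formula L}
    (h : ∀ m : M.carrier s, M.val (Env.cons m ρ) A = ⊤) : M.val ρ (.all s A) = ⊤ :=
  iInf_eq_top.2 fun m => by rw [h, himp_top]

theorem Model.val_imp_eq_top {L : Signature} {H : Type} [Order.Frame H] {M : Model L H}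
    {ρ : Env L M.carrier} {A B : Formula L} : M.val ρ (.imp A B) = ⊤ ↔ M.val ρ A ≤ M.val ρ B :=
  himp_eq_top_iff

theorem Model.val_allN_eq_top {L : Signature} {H : Type} [Order.Frame H] {M : Model L H}
    {s : L.Srt} {A : Formula L} (h : ∀ ρ, M.val ρ A = ⊤) (n : ℕ) (ρ : Env L M.carrier) :
    M.val ρ (Formula.allN s n A) = ⊤ := by
  induction n generalizing ρ with
  | zero => exact h ρ
  | succ n ih => exact val_all_eq_top fun m => ih _

namespace HAModulo

/-- The step hypothesis is quantified only over `N`; the premise that `u` is in `N`, supplied by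
`le_hval_of_le_vNat`, allows it to be applied. -/
theorem val_induction (P : HA.Fm) (ρ : Env HA.lang naturals.carrier) :
    naturals.val ρ (HA.induction P) = ⊤ := by
  rw [HA.induction, Model.val_imp_eq_top, Model.val, le_himp_iff, Model.val_inst, HA.eval_zero,
    mzero_naturals, ← scons_eq_cons]
  refine le_iInf fun t => le_himp_iff.2 ?_
  rw [← scons_eq_cons]
  refine le_trans (le_hval_of_le_vNat _ _ inf_le_right
    ((inf_le_left.trans inf_le_left).trans (hval_translate (scons zero (ρ ())) P).ge)
    fun u z' hz hu h => ?_) (hval_translate (scons t (ρ ())) P).le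
  replace h := h.trans (hval_translate (scons u (ρ ())) P).le
  refine le_trans ?_ (hval_translate (scons (succ u) (ρ ())) P).ge
  have h1 : z' ≤ naturals.ext () u ⇨
      naturals.val (Env.cons (L := HA.lang) (s := ()) u ρ) (.imp P (P.subst HA.succSubst)) :=
    (hz.trans (inf_le_left.trans inf_le_right)).trans (iInf_le _ u)
  rw [Model.val, Model.val_subst, HA.eval_succSubst, ← scons_eq_cons, ← scons_eq_cons] at h1
  exact (le_inf le_rfl h).trans (le_himp_iff.1 ((le_inf le_rfl hu).trans (le_himp_iff.1 h1)))

theorem axioms_val {A : HA.Fm} (h : HA.Axiom A) (ρ : Env HA.lang naturals.carrier) :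
    naturals.val ρ A = ⊤ := by
  cases h with
  | induct n P hP => exact Model.val_allN_eq_top (val_induction P) n ρ
  | eq_refl =>
    refine Model.val_all_eq_top fun t => ?_
    simpa using vEq_refl t
  | eq_symm =>
    refine Model.val_all_eq_top fun t => Model.val_all_eq_top fun u => Model.val_imp_eq_top.2 ?_
    simpa using vEq_symm le_rfl
  | eq_trans =>
    refine Model.val_all_eq_top fun t => Model.val_all_eq_top fun u =>
      Model.val_all_eq_top fun v => Model.val_imp_eq_top.2 (le_himp_iff.2 ?_)
    simpa using vEq_trans inf_le_left inf_le_right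
  | eq_succ =>
    refine Model.val_all_eq_top fun t => Model.val_all_eq_top fun u => Model.val_imp_eq_top.2 ?_
    simpa using vEq_succ le_rfl
  | eq_add =>
    refine Model.val_all_eq_top fun t => Model.val_all_eq_top fun u =>
      Model.val_all_eq_top fun v => Model.val_all_eq_top fun w =>
      Model.val_imp_eq_top.2 (le_himp_iff.2 ?_)
    simpa using vEq_add inf_le_left inf_le_right
  | eq_mul =>
    refine Model.val_all_eq_top fun t => Model.val_all_eq_top fun u =>
      Model.val_all_eq_top fun v => Model.val_all_eq_top fun w =>
      Model.val_imp_eq_top.2 (le_himp_iff.2 ?_)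
    simpa using vEq_mul inf_le_left inf_le_right
  | succ_inj =>
    refine Model.val_all_eq_top fun t => Model.val_all_eq_top fun u => Model.val_imp_eq_top.2 ?_
    simpa using vEq_of_succ le_rfl
  | zero_ne_succ =>
    refine Model.val_all_eq_top fun t => Model.val_imp_eq_top.2 ?_
    simpa [Model.val] using vEq_zero_succ t
  | zero_add =>
    refine Model.val_all_eq_top fun t => ?_
    simpa [vEq_congr (congr_zero_add t) (.refl t)] using vEq_refl t
  | succ_add =>
    refine Model.val_all_eq_top fun t => Model.val_all_eq_top fun u => ?_
    simpa [vEq_congr (congr_succ_add t u) (.refl _)] using vEq_refl _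
  | zero_mul =>
    refine Model.val_all_eq_top fun t => ?_
    simpa [vEq_congr (congr_zero_mul t) (.refl _)] using vEq_refl _
  | succ_mul =>
    refine Model.val_all_eq_top fun t => Model.val_all_eq_top fun u => ?_
    simpa [vEq_congr (congr_succ_mul t u) (.refl _)] using vEq_refl _

end HAModulo

/-! ### Closedness of translations, and the direction from HA to the theory modulo -/

namespace HAN

theorem bounded_ofHATerm {k : Unit → ℕ} {s : HA.lang.Srt} {t : Term HA.lang s}
    (h : t.Bounded k) : (ofHATerm t).Bounded k := by
  induction t with
  | var s n => exact h
  | func f ts ih => exact fun i => ih i (h i)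

theorem bounded_translate {k : Unit → ℕ} {A : HA.Fm} (h : A.Bounded k) :
    (translate A).Bounded k := by
  induction A generalizing k with
  | rel r ts => exact fun i => bounded_ofHATerm (h i)
  | top => trivial
  | bot => trivial
  | and A B ihA ihB => exact ⟨ihA h.1, ihB h.2⟩
  | or A B ihA ihB => exact ⟨ihA h.1, ihB h.2⟩
  | imp A B ihA ihB => exact ⟨ihA h.1, ihB h.2⟩
  | all s A ih => exact ⟨fun _ => by simp [Term.Bounded, var], ih h⟩
  | ex s A ih => exact ⟨fun _ => by simp [Term.Bounded, var], ih h⟩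

end HAN

namespace HAModulo

theorem bounded_ofHANTerm {k : Unit → ℕ} {k' : Srt → ℕ} (hk : k' .num = k ())
    {s : HAN.lang.Srt} {t : Term HAN.lang s} (h : t.Bounded k) : (ofHANTerm t).Bounded k' := by
  induction t with
  | var s n => exact lt_of_lt_of_eq h hk.symm
  | func f ts ih => exact fun i => ih i (h i)

theorem bounded_ofHAN {k : Unit → ℕ} {k' : Srt → ℕ} (hk : k' .num = k ()) {A : HAN.Fm}
    (h : A.Bounded k) : (ofHAN A).Bounded k' := by
  induction A generalizing k k' with
  | rel r ts => exact fun i => bounded_ofHANTerm hk (h i)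
  | top => trivial
  | bot => trivial
  | and A B ihA ihB => exact ⟨ihA hk h.1, ihB hk h.2⟩
  | or A B ihA ihB => exact ⟨ihA hk h.1, ihB hk h.2⟩
  | imp A B ihA ihB => exact ⟨ihA hk h.1, ihB hk h.2⟩
  | all s A ih => exact ih (by simp [hk]) h
  | ex s A ih => exact ih (by simp [hk]) h

/-- The relativizations of the theorems of HA are theorems of the theory modulo. -/
theorem provable_of_HA_provable {A : HA.Fm} (hA : A.Closed) (h : HA.Provable A) :
    Provable (ofHAN (HAN.translate A)) := by
  -- Soundness needs an environment whose values fully exist, and `0` is in `N` with value `⊤`. The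
  -- choice is harmless as `A` is closed.
  have h1 : (⊤ : V) ≤ naturals.val (fun _ _ => zero) A :=
    Model.le_val_of_proves (fun z f ts h => le_vNat_func f ts h) (fun _ _ _ h => h ▸ rfl) h
      (fun _ _ => vNat_zero.ge) (fun C hC => (axioms_val hC _).ge)
  have h2 : tm.val (subst₂ zero zero) (ofHAN (HAN.translate A)) =
      naturals.val (fun _ => subst₂ zero zero Srt.num) A :=
    (val_ofHAN tm _ _).trans (HAN.val_translate _ (fun _ _ => rfl) _ A)
  have h3 : subst₂ zero zero Srt.num = fun _ => zero := by
    funext n; cases n <;> rfl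
  have h4 : (ofHAN (HAN.translate A)).Closed :=
    bounded_ofHAN rfl (HAN.bounded_translate hA)
  rw [Theory.termModel_val, h4.subst_eq, h3] at h2
  exact (Theory.toVal_eq_top (T := rules.theory)).1 (h2.trans (top_le_iff.1 h1))

end HAModulo

/-! ### Forcing clauses for the operations of a frame -/

section Frame

variable {H : Type} [Order.Frame H] {z : H}

/-- The Kripke–Joyal clause for implication. Together with the congruence lemmas below, it compares
values stage by stage, under an equivalence that is known only below `z`. -/
theorem le_himp_iff_forall {a b : H} : z ≤ a ⇨ b ↔ ∀ z' ≤ z, z' ≤ a → z' ≤ b :=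
  ⟨fun h _ hz ha => (le_inf hz ha).trans (le_himp_iff.1 h),
    fun h => le_himp_iff.2 (h _ inf_le_left inf_le_right)⟩

theorem le_iSup_congr {ι : Type} {F G : ι → H} (h : ∀ i, ∀ z' ≤ z, (z' ≤ F i ↔ z' ≤ G i)) :
    z ≤ ⨆ i, F i ↔ z ≤ ⨆ i, G i :=
  ⟨fun hz => le_of_le_iSup hz fun i z' hz' hi => ((h i z' hz').1 hi).trans (le_iSup G i),
    fun hz => le_of_le_iSup hz fun i z' hz' hi => ((h i z' hz').2 hi).trans (le_iSup F i)⟩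

theorem le_inf_congr {a b c d : H} (h : z ≤ a ↔ z ≤ c) (h' : z ≤ b ↔ z ≤ d) :
    z ≤ a ⊓ b ↔ z ≤ c ⊓ d := by
  simp only [le_inf_iff, h, h']

theorem le_sup_congr {a b c d : H} (h : ∀ z' ≤ z, (z' ≤ a ↔ z' ≤ c))
    (h' : ∀ z' ≤ z, (z' ≤ b ↔ z' ≤ d)) : z ≤ a ⊔ b ↔ z ≤ c ⊔ d :=
  ⟨fun hz => le_of_le_sup hz (fun z' hz' hi => ((h z' hz').1 hi).trans le_sup_left)
      fun z' hz' hi => ((h' z' hz').1 hi).trans le_sup_right,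
    fun hz => le_of_le_sup hz (fun z' hz' hi => ((h z' hz').2 hi).trans le_sup_left)
      fun z' hz' hi => ((h' z' hz').2 hi).trans le_sup_right⟩

theorem le_himp_congr {a b c d : H} (h : ∀ z' ≤ z, (z' ≤ a ↔ z' ≤ c))
    (h' : ∀ z' ≤ z, (z' ≤ b ↔ z' ≤ d)) : z ≤ a ⇨ b ↔ z ≤ c ⇨ d := by
  rw [le_himp_iff_forall, le_himp_iff_forall]
  exact forall_congr' fun z' => forall_congr' fun hz => by rw [h z' hz, h' z' hz]

end Frame

theorem Model.val_of_val_allN {L : Signature} {H : Type} [Order.Frame H] {M : Model L H}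
    (hM : ∀ s m, M.ext s m = ⊤) {s : L.Srt} {A : Formula L} (n : ℕ)
    (h : ∀ ρ, M.val ρ (Formula.allN s n A) = ⊤) (ρ : Env L M.carrier) : M.val ρ A = ⊤ := by
  induction n with
  | zero => exact h ρ
  | succ n ih =>
    refine ih fun ρ => ?_
    -- This environment is `ρ` with its value at index `0` of sort `s` dropped; inserting that value
    -- again gives back `ρ`.
    have h1 := iInf_eq_top.1 (h fun s' k => if s' = s then ρ s' (k + 1) else ρ s' k) (ρ s 0)
    rw [hM, top_himp] at h1
    rwa [← Env.eq_cons (ρ' := ρ) (ρ := fun s' k => if s' = s then ρ s' (k + 1) else ρ s' k) rfl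
      (fun n => by simp) (fun s' n hs => by simp [hs])] at h1

/-! ### The axioms of HA read in a frame-valued model -/

namespace HA

theorem cons_eq_scons {M : Unit → Type} (a : M ()) (σ : ℕ → M ()) :
    Env.cons (L := lang) (s := ()) a (fun _ => σ) = fun _ => HAModulo.scons a σ := by
  symm
  apply Env.eq_cons (L := lang) (s := ())
  · rfl
  · intro n; rfl
  · exact fun s' n h => absurd rfl h

/-- A model of Heyting arithmetic all of whose elements exist. -/
structure IsModel {H : Type} [Order.Frame H] (M : Model lang H) : Prop where
  ext_eq : ∀ s m, M.ext s m = ⊤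
  axioms_val : ∀ A, Axiom A → ∀ ρ, M.val ρ A = ⊤

open HAModulo (scons)

variable {H : Type} [Order.Frame H] {M : Model lang H}

/-- The value of a proposition. -/
abbrev sval (M : Model lang H) (σ : ℕ → Dom M) (A : Fm) : H := M.val (fun _ => σ) A

theorem sval_all (hM : IsModel M) (σ : ℕ → Dom M) (s : Unit) (A : Fm) :
    sval M σ (.all s A) = ⨅ a, sval M (scons a σ) A :=
  iInf_congr fun a => by rw [hM.ext_eq, top_himp, cons_eq_scons a σ]

theorem sval_ex (hM : IsModel M) (σ : ℕ → Dom M) (s : Unit) (A : Fm) :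
    sval M σ (.ex s A) = ⨆ a, sval M (scons a σ) A :=
  iSup_congr fun a => by rw [hM.ext_eq, top_inf_eq, cons_eq_scons a σ]

namespace IsModel

theorem axioms_sval (hM : IsModel M) {A : Fm} (hA : Axiom A) (σ : ℕ → Dom M) :
    sval M σ A = ⊤ := hM.axioms_val A hA _

theorem induct (hM : IsModel M) (P : Fm) (σ : ℕ → Dom M) {z : H}
    (h0 : z ≤ sval M (scons (mzero M) σ) P)
    (hs : ∀ a, ∀ z' ≤ z, z' ≤ sval M (scons a σ) P → z' ≤ sval M (scons (msucc M a) σ) P)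
    (a : Dom M) : z ≤ sval M (scons a σ) P := by
  obtain ⟨k, hk⟩ := P.exists_bounded
  -- The axiom is universally closed over `k ()` parameters; stripping these quantifiers gives
  -- induction at the parameters `σ`.
  have h := Model.val_of_val_allN hM.ext_eq (k ()) (hM.axioms_val _
    (.induct (k ()) P (hk.mono fun _ => Nat.le_succ _))) (fun _ => σ)
  rw [HA.induction, Model.val_imp_eq_top, Model.val_inst, eval_zero, cons_eq_scons (mzero M) σ] at h
  change _ ≤ sval M σ _ ⇨ sval M σ _ at h
  rw [sval_all hM, sval_all hM] at h
  have h1 := le_himp_iff_forall.1 (h0.trans h) z le_rfl (le_iInf fun a => ?_)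
  · exact h1.trans (iInf_le _ a)
  · refine le_himp_iff_forall.2 fun z' hz h => ?_
    rw [Model.val_subst, ← cons_eq_scons a σ, eval_succSubst, cons_eq_scons (msucc M a) σ]
    exact hs a z' hz h

section

variable {a b c d : Dom M} {z : H}

theorem refl (hM : IsModel M) (a : Dom M) : z ≤ meq M a a := by
  have h := hM.axioms_sval .eq_refl fun _ => a
  simp only [sval_all hM, iInf_eq_top] at h
  simpa [scons] using (h a).ge.trans' le_top

theorem symm (hM : IsModel M) (h : z ≤ meq M a b) : z ≤ meq M b a := by
  have h1 := hM.axioms_sval .eq_symm fun _ => a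
  simp only [sval_all hM, iInf_eq_top, Model.val_imp_eq_top] at h1
  simpa [scons] using h.trans (by simpa [scons] using h1 a b)

theorem trans (hM : IsModel M) (h : z ≤ meq M a b) (h' : z ≤ meq M b c) : z ≤ meq M a c := by
  have h1 := hM.axioms_sval .eq_trans fun _ => a
  simp only [sval_all hM, iInf_eq_top, Model.val_imp_eq_top] at h1
  have h2 := h1 a b c
  simp only [Model.val, le_himp_iff] at h2
  exact (le_inf h h').trans (by simpa [scons] using h2)

theorem succ_congr (hM : IsModel M) (h : z ≤ meq M a b) :
    z ≤ meq M (msucc M a) (msucc M b) := by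
  have h1 := hM.axioms_sval .eq_succ fun _ => a
  simp only [sval_all hM, iInf_eq_top, Model.val_imp_eq_top] at h1
  exact h.trans (by simpa [scons] using h1 a b)

theorem add_congr (hM : IsModel M) (h : z ≤ meq M a b) (h' : z ≤ meq M c d) :
    z ≤ meq M (madd M a c) (madd M b d) := by
  have h1 := hM.axioms_sval .eq_add fun _ => a
  simp only [sval_all hM, iInf_eq_top, Model.val_imp_eq_top] at h1
  have h2 := h1 a b c d
  simp only [Model.val, le_himp_iff] at h2
  exact (le_inf h h').trans (by simpa [scons] using h2)

theorem mul_congr (hM : IsModel M) (h : z ≤ meq M a b) (h' : z ≤ meq M c d) :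
    z ≤ meq M (mmul M a c) (mmul M b d) := by
  have h1 := hM.axioms_sval .eq_mul fun _ => a
  simp only [sval_all hM, iInf_eq_top, Model.val_imp_eq_top] at h1
  have h2 := h1 a b c d
  simp only [Model.val, le_himp_iff] at h2
  exact (le_inf h h').trans (by simpa [scons] using h2)

theorem succ_inj (hM : IsModel M) (h : z ≤ meq M (msucc M a) (msucc M b)) : z ≤ meq M a b := by
  have h1 := hM.axioms_sval .succ_inj fun _ => a
  simp only [sval_all hM, iInf_eq_top, Model.val_imp_eq_top] at h1
  exact h.trans (by simpa [scons] using h1 a b)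

theorem zero_ne_succ (hM : IsModel M) (h : z ≤ meq M (mzero M) (msucc M a)) : z ≤ ⊥ := by
  have h1 := hM.axioms_sval .zero_ne_succ fun _ => a
  simp only [sval_all hM, iInf_eq_top, Model.val_imp_eq_top, Formula.neg] at h1
  exact h.trans (by simpa [scons, Model.val] using h1 a)

theorem zero_add (hM : IsModel M) (a : Dom M) : z ≤ meq M (madd M (mzero M) a) a := by
  have h := hM.axioms_sval .zero_add fun _ => a
  simp only [sval_all hM, iInf_eq_top] at h
  simpa [scons] using (h a).ge.trans' le_top

theorem succ_add (hM : IsModel M) (a b : Dom M) :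
    z ≤ meq M (madd M (msucc M a) b) (msucc M (madd M a b)) := by
  have h := hM.axioms_sval .succ_add fun _ => a
  simp only [sval_all hM, iInf_eq_top] at h
  simpa [scons] using (h a b).ge.trans' le_top

theorem zero_mul (hM : IsModel M) (a : Dom M) : z ≤ meq M (mmul M (mzero M) a) (mzero M) := by
  have h := hM.axioms_sval .zero_mul fun _ => a
  simp only [sval_all hM, iInf_eq_top] at h
  simpa [scons] using (h a).ge.trans' le_top

theorem succ_mul (hM : IsModel M) (a b : Dom M) :
    z ≤ meq M (mmul M (msucc M a) b) (madd M (mmul M a b) b) := by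
  have h := hM.axioms_sval .succ_mul fun _ => a
  simp only [sval_all hM, iInf_eq_top] at h
  simpa [scons] using (h a b).ge.trans' le_top

/-- Makes the predecessor relation total, in `predRel`. -/
theorem zero_or_succ (hM : IsModel M) (a : Dom M) :
    z ≤ meq M a (mzero M) ⊔ ⨆ b, meq M a (msucc M b) := by
  have key : ∀ c, sval M (scons c fun _ => a) (.or (eq (var 0) zero)
      (.ex (L := lang) () (eq (var 1) (succ (var 0))))) =
        meq M c (mzero M) ⊔ ⨆ b, meq M c (msucc M b) := by
    intro c
    change sval M _ _ ⊔ sval M _ _ = _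
    rw [sval_ex hM]
    simp only [val_eq, eval_var, eval_zero, eval_succ, scons]
  rw [← key]
  refine hM.induct _ _ ?_ (fun b z' _ _ => ?_) a
  · rw [key]; exact (hM.refl _).trans le_sup_left
  · rw [key]
    exact (hM.refl _).trans
      ((le_iSup (fun d => meq M (msucc M b) (msucc M d)) b).trans le_sup_right)

end

end IsModel

/-! ### Definable numbers -/

/-- A frame-valued singleton: a number given by a description. -/
@[ext] structure Pt (M : Model lang H) where
  mem : Dom M → H
  iSup_mem : ⨆ a, mem a = ⊤
  unique : ∀ {a b : Dom M} {z : H}, z ≤ mem a → z ≤ mem b → z ≤ meq M a b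
  mem_congr : ∀ {a b : Dom M} {z : H}, z ≤ mem a → z ≤ meq M a b → z ≤ mem b

namespace Pt

/-- A definable number is locally an element of `M`, so an inequality may be proved on the parts
where an element represents it. -/
theorem elim (m : Pt M) {z x : H} (h : ∀ a, ∀ z' ≤ z, z' ≤ m.mem a → z' ≤ x) : z ≤ x :=
  le_of_le_iSup (m.iSup_mem ▸ le_top) h

theorem mem_iff (m : Pt M) {a b : Dom M} {z : H} (h : z ≤ m.mem a) :
    z ≤ m.mem b ↔ z ≤ meq M a b := ⟨m.unique h, m.mem_congr h⟩

/-- Between singletons inclusion is equality: `m` is inhabited and `m'` has at most one member. The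
result is an equality in Lean, as the term rules require, where `M` has only an `H`-valued one. -/
theorem eq_of_le {m m' : Pt M}
    (h : ∀ a (z : H), z ≤ m.mem a → z ≤ m'.mem a) : m = m' := by
  refine Pt.ext (funext fun a => le_antisymm (h a _ le_rfl) ?_)
  refine m.elim fun b z hz hb => ?_
  exact m.mem_congr hb (m'.unique (h b z hb) hz)

/-- The element `a`. -/
def pure (hM : IsModel M) (a : Dom M) : Pt M where
  mem b := meq M a b
  iSup_mem := top_le_iff.1 ((hM.refl a).trans (le_iSup (meq M a) a))
  unique h h' := hM.trans (hM.symm h) h'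
  mem_congr h h' := hM.trans h h'

end Pt

/-- A frame-valued functional relation. -/
structure FunRel (M : Model lang H) where
  rel : Dom M → Dom M → H
  total : ∀ a, ⨆ b, rel a b = ⊤
  unique : ∀ {a b b' : Dom M} {z : H}, z ≤ rel a b → z ≤ rel a b' → z ≤ meq M b b'
  congr : ∀ {a a' b b' : Dom M} {z : H}, z ≤ rel a b → z ≤ meq M a a' → z ≤ meq M b b' →
    z ≤ rel a' b'

/-- The graph of the successor. -/
def succRel (hM : IsModel M) : FunRel M where
  rel a b := meq M (msucc M a) b
  total a := top_le_iff.1 ((hM.refl _).trans (le_iSup (meq M (msucc M a)) (msucc M a)))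
  unique h h' := hM.trans (hM.symm h) h'
  congr h h' h'' := hM.trans (hM.symm (hM.succ_congr h')) (hM.trans h h'')

/-- The graph of the predecessor. -/
def predRel (hM : IsModel M) : FunRel M where
  rel a b := meq M a (mzero M) ⊓ meq M b (mzero M) ⊔ meq M a (msucc M b)
  total a := by
    refine top_le_iff.1 (le_of_le_sup (hM.zero_or_succ a) (fun z _ h => ?_) fun z _ h => ?_)
    · exact (le_inf h (hM.refl _)).trans (le_sup_left.trans
        (le_iSup (fun b => meq M a (mzero M) ⊓ meq M b (mzero M) ⊔ meq M a (msucc M b)) _))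
    · refine le_of_le_iSup h fun b z' _ h => h.trans (le_sup_right.trans
        (le_iSup (fun b => meq M a (mzero M) ⊓ meq M b (mzero M) ⊔ meq M a (msucc M b)) b))
  unique h h' := by
    refine le_of_le_sup h (fun z hz h => ?_) fun z hz h => ?_
    · have h1 := h.trans inf_le_left
      have h2 := h.trans inf_le_right
      -- The mixed cases would identify `0` with a successor.
      refine le_of_le_sup (hz.trans h') (fun z hz h => ?_) fun z hz h => ?_
      · exact hM.trans (hz.trans h2) (hM.symm (h.trans inf_le_right))
      · exact (hM.zero_ne_succ (hM.trans (hM.symm (hz.trans h1)) h)).trans bot_le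
    · refine le_of_le_sup (hz.trans h') (fun z hz h' => ?_) fun z hz h' => ?_
      · exact (hM.zero_ne_succ (hM.trans (hM.symm (h'.trans inf_le_left)) (hz.trans h))).trans
          bot_le
      · exact hM.succ_inj (hM.trans (hM.symm (hz.trans h)) h')
  congr h h' h'' := by
    refine le_of_le_sup h (fun z hz h => ?_) fun z hz h => ?_
    · exact (le_inf (hM.trans (hM.symm (hz.trans h')) (h.trans inf_le_left))
        (hM.trans (hM.symm (hz.trans h'')) (h.trans inf_le_right))).trans le_sup_left
    · exact (hM.trans (hM.symm (hz.trans h')) (hM.trans h (hM.succ_congr (hz.trans h'')))).trans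
        le_sup_right

namespace Pt

/-- The image under a functional relation. -/
def map (R : FunRel M) (hM : IsModel M) (m : Pt M) : Pt M where
  mem b := ⨆ a, m.mem a ⊓ R.rel a b
  iSup_mem := top_le_iff.1 <| m.elim fun a _ _ ha =>
    le_of_le_iSup (F := R.rel a) (R.total a ▸ le_top) fun b _ hz hb =>
      (le_inf (hz.trans ha) hb).trans ((le_iSup (fun a => m.mem a ⊓ R.rel a b) a).trans
        (le_iSup (fun b => ⨆ a, m.mem a ⊓ R.rel a b) b))
  unique h h' := le_of_le_iSup h fun _ _ hz ha => le_of_le_iSup (hz.trans h') fun _ _ hz' ha' =>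
    R.unique (R.congr (hz'.trans (ha.trans inf_le_right))
      (m.unique (hz'.trans (ha.trans inf_le_left)) (ha'.trans inf_le_left)) (hM.refl _))
      (ha'.trans inf_le_right)
  mem_congr h h' := le_of_le_iSup h fun a _ hz ha =>
    (le_inf (ha.trans inf_le_left) (R.congr (ha.trans inf_le_right) (hM.refl _)
      (hz.trans h'))).trans (le_iSup (fun a => m.mem a ⊓ R.rel a _) a)

theorem le_mem_map {R : FunRel M} (hM : IsModel M) {m : Pt M} {a b : Dom M} {z : H}
    (h : z ≤ m.mem a) (h' : z ≤ R.rel a b) : z ≤ (m.map R hM).mem b :=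
  (le_inf h h').trans (le_iSup (fun a => m.mem a ⊓ R.rel a b) a)

/-- The image under a binary operation. -/
def map₂ (op : Dom M → Dom M → Dom M) (hM : IsModel M)
    (hop : ∀ {a b c d : Dom M} {z : H}, z ≤ meq M a b → z ≤ meq M c d →
      z ≤ meq M (op a c) (op b d)) (m m' : Pt M) : Pt M where
  mem c := ⨆ a, ⨆ b, m.mem a ⊓ m'.mem b ⊓ meq M (op a b) c
  iSup_mem := top_le_iff.1 <| m.elim fun a _ _ ha => m'.elim fun b _ hz hb =>
    (le_inf (le_inf (hz.trans ha) hb) (hM.refl (op a b))).trans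
      ((le_iSup (fun b' => m.mem a ⊓ m'.mem b' ⊓ meq M (op a b') (op a b)) b).trans
        ((le_iSup (fun a' => ⨆ b', m.mem a' ⊓ m'.mem b' ⊓ meq M (op a' b') (op a b)) a).trans
          (le_iSup (fun c => ⨆ a, ⨆ b, m.mem a ⊓ m'.mem b ⊓ meq M (op a b) c) (op a b))))
  unique h h' := by
    refine le_of_le_iSup h fun a z hz h => le_of_le_iSup h fun b z' hz' h => ?_
    refine le_of_le_iSup ((hz'.trans hz).trans h') fun a' w hw h' =>
      le_of_le_iSup h' fun b' w' hw' h' => ?_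
    have h := (hw'.trans hw).trans h
    rw [le_inf_iff, le_inf_iff] at h h'
    exact hM.trans (hM.symm h.2) (hM.trans (hop (m.unique h.1.1 h'.1.1)
      (m'.unique h.1.2 h'.1.2)) h'.2)
  mem_congr {c d _} h h' := by
    refine le_of_le_iSup h fun a z hz h => le_of_le_iSup h fun b z' hz' h => ?_
    exact (le_inf (h.trans inf_le_left) (hM.trans (h.trans inf_le_right)
      ((hz'.trans hz).trans h'))).trans
      ((le_iSup (fun b' => m.mem a ⊓ m'.mem b' ⊓ meq M (op a b') d) b).trans
        (le_iSup (fun a' => ⨆ b', m.mem a' ⊓ m'.mem b' ⊓ meq M (op a' b') d) a))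

theorem le_mem_map₂ {op : Dom M → Dom M → Dom M} (hM : IsModel M)
    (hop : ∀ {a b c d : Dom M} {z : H}, z ≤ meq M a b → z ≤ meq M c d →
      z ≤ meq M (op a c) (op b d)) {m m' : Pt M} {a b : Dom M} {z : H}
    (h : z ≤ m.mem a) (h' : z ≤ m'.mem b) : z ≤ (map₂ op hM hop m m').mem (op a b) :=
  (le_inf (le_inf h h') (hM.refl (op a b))).trans
      ((le_iSup (fun b' => m.mem a ⊓ m'.mem b' ⊓ meq M (op a b') (op a b)) b).trans
        (le_iSup (fun a' => ⨆ b', m.mem a' ⊓ m'.mem b' ⊓ meq M (op a' b') (op a b)) a))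

variable (hM : IsModel M)

/-- The successor. -/
def succ (m : Pt M) : Pt M := m.map (succRel hM) hM

/-- The predecessor. -/
def pred (m : Pt M) : Pt M := m.map (predRel hM) hM

/-- The sum. -/
def add (m m' : Pt M) : Pt M := map₂ (madd M) hM hM.add_congr m m'

/-- The product. -/
def mul (m m' : Pt M) : Pt M := map₂ (mmul M) hM hM.mul_congr m m'

variable {a b : Dom M} {z : H} {m m' : Pt M}

theorem le_mem_pure (a : Dom M) : z ≤ (pure hM a).mem a := hM.refl a

theorem le_mem_succ (h : z ≤ m.mem a) : z ≤ (succ hM m).mem (msucc M a) :=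
  le_mem_map hM h (hM.refl _)

theorem le_mem_add (h : z ≤ m.mem a) (h' : z ≤ m'.mem b) :
    z ≤ (add hM m m').mem (madd M a b) := le_mem_map₂ hM hM.add_congr h h'

theorem le_mem_mul (h : z ≤ m.mem a) (h' : z ≤ m'.mem b) :
    z ≤ (mul hM m m').mem (mmul M a b) := le_mem_map₂ hM hM.mul_congr h h'

theorem pred_zero : pred hM (pure hM (mzero M)) = pure hM (mzero M) :=
  Eq.symm <| eq_of_le fun _ _ h => le_mem_map hM (le_mem_pure hM _)
    ((le_inf (hM.refl _) (hM.symm h)).trans le_sup_left)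

theorem pred_succ (m : Pt M) : pred hM (succ hM m) = m :=
  Eq.symm <| eq_of_le fun _ _ h => le_mem_map hM (le_mem_succ hM h)
    ((hM.refl _).trans le_sup_right)

theorem zero_add (m : Pt M) : add hM (pure hM (mzero M)) m = m :=
  Eq.symm <| eq_of_le fun a _ h =>
    (add hM _ m).mem_congr (le_mem_add hM (le_mem_pure hM _) h) (hM.zero_add a)

theorem succ_add (m m' : Pt M) : add hM (succ hM m) m' = succ hM (add hM m m') :=
  -- Represent both arguments by elements, compute both sides there, and compare them by the
  -- corresponding axiom of HA.
  eq_of_le fun _ _ h => m.elim fun _ _ hz ha => m'.elim fun _ _ hz' hb =>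
    mem_congr _ (le_mem_succ hM (le_mem_add hM (hz'.trans ha) hb)) <|
      hM.trans (hM.symm (hM.succ_add _ _)) <|
        unique _ (le_mem_add hM (le_mem_succ hM (hz'.trans ha)) hb) ((hz'.trans hz).trans h)

theorem zero_mul (m : Pt M) : mul hM (pure hM (mzero M)) m = pure hM (mzero M) :=
  eq_of_le fun _ _ h => m.elim fun _ _ hz ha =>
    hM.trans (hM.symm (hM.zero_mul _)) <|
      unique _ (le_mem_mul hM (le_mem_pure hM _) ha) (hz.trans h)

theorem succ_mul (m m' : Pt M) : mul hM (succ hM m) m' = add hM (mul hM m m') m' :=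
  eq_of_le fun _ _ h => m.elim fun _ _ hz ha => m'.elim fun _ _ hz' hb =>
    mem_congr _ (le_mem_add hM (le_mem_mul hM (hz'.trans ha) hb) hb) <|
      hM.trans (hM.symm (hM.succ_mul _ _)) <|
        unique _ (le_mem_mul hM (le_mem_succ hM (hz'.trans ha)) hb) ((hz'.trans hz).trans h)

end Pt

end HA

theorem HAN.cons_eq_scons {M : Unit → Type} (a : M ()) (σ : ℕ → M ()) :
    Env.cons (L := HAN.lang) (s := ()) a (fun _ => σ) = fun _ => HAModulo.scons a σ := by
  symm
  apply Env.eq_cons (L := HAN.lang) (s := ())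
  · rfl
  · intro n; rfl
  · exact fun s' n h => absurd rfl h

namespace HA

open HAModulo (scons)

variable {H : Type} [Order.Frame H] {M : Model lang H}

/-! ### The one-sorted model on definable numbers -/

/-- The definable numbers; all of them satisfy `N`. -/
abbrev ptModel (hM : IsModel M) : Model HAN.lang H where
  carrier _ := Pt M
  fn
    | .ha .zero => fun _ => Pt.pure hM (mzero M)
    | .ha .succ => fun ts => Pt.succ hM (ts 0)
    | .ha .add => fun ts => Pt.add hM (ts 0) (ts 1)
    | .ha .mul => fun ts => Pt.mul hM (ts 0) (ts 1)
    | .pred => fun ts => Pt.pred hM (ts 0)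
  rel
    | .eq => fun ts => ⨆ a, (ts 0).mem a ⊓ (ts 1).mem a
    | .null => fun ts => (ts 0).mem (mzero M)
    | .nat => fun _ => ⊤
  ext _ _ := ⊤

/-- The extent to which the first `k` definable numbers are given elements. -/
def near : ℕ → (ℕ → Pt M) → (ℕ → Dom M) → H
  | 0, _, _ => ⊤
  | k + 1, ρ, σ => (ρ 0).mem (σ 0) ⊓ near k (fun n => ρ (n + 1)) (fun n => σ (n + 1))

theorem le_near_scons {k : ℕ} {m : Pt M} {a : Dom M} {ρ : ℕ → Pt M} {σ : ℕ → Dom M} {z : H}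
    (h : z ≤ m.mem a) (h' : z ≤ near k ρ σ) : z ≤ near (k + 1) (scons m ρ) (scons a σ) :=
  le_inf h h'

theorem le_mem_of_le_near {k : ℕ} {ρ : ℕ → Pt M} {σ : ℕ → Dom M} {z : H} (h : z ≤ near k ρ σ)
    {i : ℕ} (hi : i < k) : z ≤ (ρ i).mem (σ i) := by
  induction k generalizing ρ σ i with
  | zero => exact absurd hi (Nat.not_lt_zero _)
  | succ k ih =>
    cases i with
    | zero => exact h.trans inf_le_left
    | succ i => exact ih (h.trans inf_le_right) (Nat.lt_of_succ_lt_succ hi)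

/-- Iterates `Pt.elim`: finitely many definable numbers can be represented simultaneously. This is
why `near` looks only at the first `k` of them; `σ` is padded with `0` beyond. -/
theorem near_elim (k : ℕ) (ρ : ℕ → Pt M) {z x : H}
    (h : ∀ σ, ∀ z' ≤ z, z' ≤ near k ρ σ → z' ≤ x) : z ≤ x := by
  induction k generalizing ρ z with
  | zero => exact h (fun _ => mzero M) z le_rfl le_top
  | succ k ih =>
    refine (ρ 0).elim fun a z' hz ha => ih (fun n => ρ (n + 1)) fun σ z'' hz' hσ => ?_
    exact h (scons a σ) z'' (hz'.trans hz) (le_inf (hz'.trans ha) hσ)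

/-- The proposition `A` describes `F` wherever the parameters are given elements. -/
def Tracks (M : Model lang H) (k : ℕ) (F : (ℕ → Pt M) → H) (A : Fm) : Prop :=
  ∀ (z : H) (ρ : ℕ → Pt M) (σ : ℕ → Dom M), z ≤ near k ρ σ → (z ≤ F ρ ↔ z ≤ sval M σ A)

namespace Tracks

variable {k : ℕ} {F G : (ℕ → Pt M) → H} {A B : Fm}

theorem top : Tracks M k (fun _ => ⊤) .top := fun _ _ _ _ => Iff.rfl

theorem bot : Tracks M k (fun _ => ⊥) .bot := fun _ _ _ _ => Iff.rfl

theorem and (h : Tracks M k F A) (h' : Tracks M k G B) :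
    Tracks M k (fun ρ => F ρ ⊓ G ρ) (.and A B) :=
  fun z ρ σ hz => le_inf_congr (h z ρ σ hz) (h' z ρ σ hz)

theorem or (h : Tracks M k F A) (h' : Tracks M k G B) :
    Tracks M k (fun ρ => F ρ ⊔ G ρ) (.or A B) :=
  fun _ ρ σ hz => le_sup_congr (fun z' hz' => h z' ρ σ (hz'.trans hz))
    fun z' hz' => h' z' ρ σ (hz'.trans hz)

theorem imp (h : Tracks M k F A) (h' : Tracks M k G B) :
    Tracks M k (fun ρ => F ρ ⇨ G ρ) (.imp A B) :=
  fun _ ρ σ hz => le_himp_congr (fun z' hz' => h z' ρ σ (hz'.trans hz))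
    fun z' hz' => h' z' ρ σ (hz'.trans hz)

/-- Quantifying over definable numbers or over elements amounts to the same: an element `a` is the
point `pure hM a`, and a point is locally an element. -/
theorem all (hM : IsModel M) (h : Tracks M (k + 1) F A) (s : Unit) :
    Tracks M k (fun ρ => ⨅ m, F (scons m ρ)) (.all s A) := by
  intro z ρ σ hz
  rw [sval_all hM, le_iInf_iff, le_iInf_iff]
  refine ⟨fun h1 a => ?_, fun h1 m => m.elim fun a z' hz' ha => ?_⟩
  · exact (h z _ _ (le_near_scons (Pt.le_mem_pure hM a) hz)).1 (h1 _)
  · exact (h z' _ _ (le_near_scons ha (hz'.trans hz))).2 (hz'.trans (h1 a))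

theorem ex (hM : IsModel M) (h : Tracks M (k + 1) F A) (s : Unit) :
    Tracks M k (fun ρ => ⨆ m, F (scons m ρ)) (.ex s A) := by
  intro z ρ σ hz
  rw [sval_ex hM]
  refine ⟨fun h1 => ?_, fun h1 => ?_⟩
  · refine le_of_le_iSup h1 fun m z' hz' h2 => m.elim fun a z'' hz'' ha => ?_
    exact ((h z'' _ _ (le_near_scons ha (hz''.trans (hz'.trans hz)))).1 (hz''.trans h2)).trans
      (le_iSup (fun a => sval M (scons a σ) A) a)
  · refine le_of_le_iSup h1 fun a z' hz' h2 => ?_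
    exact ((h z' _ _ (le_near_scons (Pt.le_mem_pure hM a) (hz'.trans hz))).2 h2).trans
      (le_iSup (fun m => F (scons m ρ)) _)

end Tracks

/-- The proposition `A` describes the graph of `f` wherever the parameters are given elements;
its variable with index `0` stands for the value of `f`. -/
def TracksPt (M : Model lang H) (k : ℕ) (f : (ℕ → Pt M) → Pt M) (A : Fm) : Prop :=
  ∀ (z : H) (ρ : ℕ → Pt M) (σ : ℕ → Dom M) (b : Dom M), z ≤ near k ρ σ →
    (z ≤ (f ρ).mem b ↔ z ≤ sval M (scons b σ) A)

/-- Renaming of variables. -/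
def ren (r : ℕ → ℕ) (A : Fm) : Fm := A.subst fun _ n => var (r n)

theorem sval_ren {r : ℕ → ℕ} {σ τ : ℕ → Dom M} (h : ∀ n, σ (r n) = τ n) (A : Fm) :
    sval M σ (ren r A) = sval M τ A := by
  rw [sval, ren, Model.val_subst]
  exact congrArg (fun τ : ℕ → Dom M => M.val (fun _ => τ) A) (funext h)

namespace TracksPt

variable {k : ℕ} {f g : (ℕ → Pt M) → Pt M} {A B : Fm}

theorem var {i : ℕ} (hi : i < k) : TracksPt M k (fun ρ => ρ i) (eq (var (i + 1)) (var 0)) := by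
  intro z ρ σ b hz
  rw [sval, val_eq]
  exact (ρ i).mem_iff (le_mem_of_le_near hz hi)

theorem zero (hM : IsModel M) :
    TracksPt M k (fun _ => Pt.pure hM (mzero M)) (eq zero (HA.var 0)) := by
  intro z ρ σ b _
  rw [sval, val_eq, eval_zero]
  rfl

/-- Under the quantifier, index `0` is the intermediate value, index `1` the output, and the
parameters start at `2`; the renaming moves the parameters of `A` past the output. -/
theorem map (hM : IsModel M) (h : TracksPt M k f A) (R : FunRel M)
    (hR : ∀ a b σ, sval M (scons a (scons b σ)) B = R.rel a b) :
    TracksPt M k (fun ρ => (f ρ).map R hM)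
      (.ex () (.and (ren (fun n => if n = 0 then 0 else n + 1) A) B)) := by
  intro z ρ σ b hz
  rw [sval_ex hM]
  refine le_iSup_congr fun a z' hz' => le_inf_congr ?_ ?_
  · rw [h z' ρ σ a (hz'.trans hz)]
    refine iff_of_eq (congrArg _ (sval_ren (fun n => ?_) A).symm)
    cases n <;> rfl
  · exact iff_of_eq (congrArg _ (hR a b σ).symm)

/-- Under the two quantifiers, indices `1` and `0` are the values of `f` and `g`, index `2` is the
output, and the parameters start at `3`. -/
theorem map₂ (hM : IsModel M) (h : TracksPt M k f A) (h' : TracksPt M k g B)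
    (op : Dom M → Dom M → Dom M)
    (hop : ∀ {a b c d : Dom M} {z : H}, z ≤ meq M a b → z ≤ meq M c d →
      z ≤ meq M (op a c) (op b d)) (t : Tm)
    (ht : ∀ (a b : Dom M) (σ : ℕ → Dom M), M.eval (fun _ => scons b (scons a σ)) t = op a b) :
    TracksPt M k (fun ρ => Pt.map₂ op hM hop (f ρ) (g ρ))
      (.ex () (.ex () (.and (.and (ren (fun n => if n = 0 then 1 else n + 2) A)
        (ren (fun n => if n = 0 then 0 else n + 2) B)) (eq t (HA.var 2))))) := by
  intro z ρ σ c hz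
  rw [sval_ex hM]
  refine le_iSup_congr fun a z' hz' => ?_
  rw [sval_ex hM]
  refine le_iSup_congr fun b z'' hz'' => le_inf_congr (le_inf_congr ?_ ?_) ?_
  · rw [h z'' ρ σ a (hz''.trans (hz'.trans hz))]
    refine iff_of_eq (congrArg _ (sval_ren (fun n => ?_) A).symm)
    cases n <;> rfl
  · rw [h' z'' ρ σ b (hz''.trans (hz'.trans hz))]
    refine iff_of_eq (congrArg _ (sval_ren (fun n => ?_) B).symm)
    cases n <;> rfl
  · rw [val_eq, ht]
    rfl

end TracksPt

/-- Terms are eliminated in favour of their graphs, since HA has no term for `Pred` but can define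
its graph. -/
theorem exists_tracksPt (hM : IsModel M) {k : ℕ} {s : HAN.lang.Srt} (t : Term HAN.lang s)
    (ht : t.Bounded fun _ => k) :
    ∃ A, TracksPt M k (fun ρ => (ptModel hM).eval (fun _ => ρ) t) A := by
  induction t with
  | var s n => exact ⟨_, TracksPt.var ht⟩
  | func f ts ih =>
    match f with
    | .ha .zero => exact ⟨_, TracksPt.zero hM⟩
    | .ha .succ =>
      obtain ⟨A, hA⟩ := ih 0 (ht 0)
      exact ⟨_, hA.map hM (succRel hM) (B := eq (succ (var 0)) (var 1))
        fun a b σ => by simp [scons, succRel]⟩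
    | .pred =>
      obtain ⟨A, hA⟩ := ih 0 (ht 0)
      exact ⟨_, hA.map hM (predRel hM) (B := .or (.and (eq (var 0) zero) (eq (var 1) zero))
        (eq (var 0) (succ (var 1)))) fun a b σ => by simp [scons, predRel, Model.val]⟩
    | .ha .add =>
      obtain ⟨A, hA⟩ := ih 0 (ht 0)
      obtain ⟨B, hB⟩ := ih 1 (ht 1)
      exact ⟨_, hA.map₂ hM hB (madd M) hM.add_congr (add (var 1) (var 0))
        fun a b σ => by simp [scons]⟩
    | .ha .mul =>
      obtain ⟨A, hA⟩ := ih 0 (ht 0)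
      obtain ⟨B, hB⟩ := ih 1 (ht 1)
      exact ⟨_, hA.map₂ hM hB (mmul M) hM.mul_congr (mul (var 1) (var 0))
        fun a b σ => by simp [scons]⟩

/-- The value of a one-sorted proposition at definable numbers. -/
abbrev pval (hM : IsModel M) (ρ : ℕ → Pt M) (P : HAN.Fm) : H := (ptModel hM).val (fun _ => ρ) P

theorem update_const (k : ℕ) (s : Unit) :
    Function.update (fun _ : Unit => k) s (k + 1) = fun _ => k + 1 := funext fun _ => by simp

/-- Elimination of `Pred`, `Null` and `N`. It carries extensionality and induction over to
comprehension classes in `Cls.comp`. -/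
theorem exists_tracks (hM : IsModel M) {k : ℕ} (P : HAN.Fm) (hP : P.Bounded fun _ => k) :
    ∃ A, Tracks M k (fun ρ => pval hM ρ P) A := by
  induction P generalizing k with
  | rel r ts =>
    match r with
    | .eq =>
      obtain ⟨A, hA⟩ := exists_tracksPt hM (ts 0) (hP 0)
      obtain ⟨B, hB⟩ := exists_tracksPt hM (ts 1) (hP 1)
      refine ⟨.ex () (.and A B), fun z ρ σ hz => ?_⟩
      rw [sval_ex hM]
      exact le_iSup_congr fun a z' hz' => le_inf_congr (hA z' ρ σ a (hz'.trans hz))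
        (hB z' ρ σ a (hz'.trans hz))
    | .null =>
      obtain ⟨A, hA⟩ := exists_tracksPt hM (ts 0) (hP 0)
      -- `Null(t)` says that the graph of `t` takes the value `0`.
      refine ⟨A.inst zero, fun z ρ σ hz => ?_⟩
      rw [sval, Model.val_inst, eval_zero, cons_eq_scons (mzero M) σ]
      exact hA z ρ σ (mzero M) hz
    | .nat => exact ⟨.top, Tracks.top⟩
  | top => exact ⟨.top, Tracks.top⟩
  | bot => exact ⟨.bot, Tracks.bot⟩
  | and P Q ihP ihQ =>
    obtain ⟨A, hA⟩ := ihP hP.1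
    obtain ⟨B, hB⟩ := ihQ hP.2
    exact ⟨_, hA.and hB⟩
  | or P Q ihP ihQ =>
    obtain ⟨A, hA⟩ := ihP hP.1
    obtain ⟨B, hB⟩ := ihQ hP.2
    exact ⟨_, hA.or hB⟩
  | imp P Q ihP ihQ =>
    obtain ⟨A, hA⟩ := ihP hP.1
    obtain ⟨B, hB⟩ := ihQ hP.2
    exact ⟨_, hA.imp hB⟩
  | all s P ih =>
    obtain ⟨A, hA⟩ := ih (k := k + 1) (update_const k s ▸ hP)
    refine ⟨_, cast (congrArg (fun F => Tracks M k F _) (funext fun ρ => ?_)) (hA.all hM s)⟩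
    exact iInf_congr fun m => by
      rw [top_himp]
      exact congrArg (fun e => (ptModel hM).val e P)
        (HAN.cons_eq_scons (M := fun _ => Pt M) m ρ).symm
  | ex s P ih =>
    obtain ⟨A, hA⟩ := ih (k := k + 1) (update_const k s ▸ hP)
    refine ⟨_, cast (congrArg (fun F => Tracks M k F _) (funext fun ρ => ?_)) (hA.ex hM s)⟩
    exact iSup_congr fun m => by
      rw [top_inf_eq]
      exact congrArg (fun e => (ptModel hM).val e P)
        (HAN.cons_eq_scons (M := fun _ => Pt M) m ρ).symm

/-- The definable numbers as a model of the language of HA. -/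
abbrev ptHA (hM : IsModel M) : Model lang H := HAN.relativize (ptModel hM)

theorem le_mem_eval (hM : IsModel M) {k : ℕ} {z : H} {ρ : ℕ → Pt M} {σ : ℕ → Dom M}
    (hz : z ≤ near k ρ σ) {s : lang.Srt} (t : Term lang s) (ht : t.Bounded fun _ => k) :
    z ≤ ((ptHA hM).eval (fun _ => ρ) t).mem (M.eval (fun _ => σ) t) := by
  induction t with
  | var s n => exact le_mem_of_le_near hz ht
  | func f ts ih =>
    match f with
    | .zero =>
      refine (Pt.le_mem_pure hM _).trans_eq (congrArg (Pt.pure hM (mzero M)).mem ?_)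
      exact congrArg (M.fn .zero) (funext fun i => Fin.elim0 i)
    | .succ =>
      refine (Pt.le_mem_succ hM (ih 0 (ht 0))).trans_eq (congrArg _ ?_)
      exact congrArg (M.fn .succ) (funext fun i => by rw [Subsingleton.elim i 0])
    | .add =>
      refine (Pt.le_mem_add hM (ih 0 (ht 0)) (ih 1 (ht 1))).trans_eq (congrArg _ ?_)
      exact congrArg (M.fn .add) (eq_fin_two fun i : Fin 2 => M.eval (fun _ => σ) (ts i)).symm
    | .mul =>
      refine (Pt.le_mem_mul hM (ih 0 (ht 0)) (ih 1 (ht 1))).trans_eq (congrArg _ ?_)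
      exact congrArg (M.fn .mul) (eq_fin_two fun i : Fin 2 => M.eval (fun _ => σ) (ts i)).symm

/-- `M` and its definable numbers agree on HA; this brings a validity in the large model back to
`M`. -/
theorem tracks_self (hM : IsModel M) {k : ℕ} (A : Fm) (hA : A.Bounded fun _ => k) :
    Tracks M k (fun ρ => (ptHA hM).val (fun _ => ρ) A) A := by
  induction A generalizing k with
  | rel r ts =>
    intro z ρ σ hz
    have h0 := le_mem_eval hM hz (ts 0) (hA 0)
    have h1 := le_mem_eval hM hz (ts 1) (hA 1)
    have h2 : sval M σ (.rel r ts) =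
        meq M (M.eval (fun _ => σ) (ts 0)) (M.eval (fun _ => σ) (ts 1)) :=
      congrArg (M.rel ()) (eq_fin_two fun i : Fin 2 => M.eval (fun _ => σ) (ts i))
    rw [h2]
    refine ⟨fun h => le_of_le_iSup h fun a z' hz' ha => ?_, fun h => ?_⟩
    · exact hM.trans (Pt.unique _ (hz'.trans h0) (ha.trans inf_le_left))
        (Pt.unique _ (ha.trans inf_le_right) (hz'.trans h1))
    · exact (le_inf (Pt.mem_congr _ h0 h) h1).trans (le_iSup (fun a =>
        ((ptHA hM).eval (fun _ => ρ) (ts 0)).mem a ⊓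
          ((ptHA hM).eval (fun _ => ρ) (ts 1)).mem a) _)
  | top => exact Tracks.top
  | bot => exact Tracks.bot
  | and A B ihA ihB => exact (ihA hA.1).and (ihB hA.2)
  | or A B ihA ihB => exact (ihA hA.1).or (ihB hA.2)
  | imp A B ihA ihB => exact (ihA hA.1).imp (ihB hA.2)
  | all s A ih =>
    refine cast (congrArg (fun F => Tracks M k F _) (funext fun ρ => ?_))
      ((ih (k := k + 1) (update_const k s ▸ hA)).all hM s)
    exact iInf_congr fun m => by
      rw [top_himp]
      exact congrArg (fun e => (ptHA hM).val e A)
        (cons_eq_scons (M := fun _ => Pt M) m ρ).symm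
  | ex s A ih =>
    refine cast (congrArg (fun F => Tracks M k F _) (funext fun ρ => ?_))
      ((ih (k := k + 1) (update_const k s ▸ hA)).ex hM s)
    exact iSup_congr fun m => by
      rw [top_inf_eq]
      exact congrArg (fun e => (ptHA hM).val e A)
        (cons_eq_scons (M := fun _ => Pt M) m ρ).symm

/-! ### The two-sorted model -/

/-- The extent to which two definable numbers are equal. -/
def ptEq (m m' : Pt M) : H := ⨆ a, m.mem a ⊓ m'.mem a

/-- A class: an extensional predicate for which induction holds. -/
structure Cls (hM : IsModel M) where
  mem : Pt M → H
  mem_congr : ∀ {m m' : Pt M} {z : H}, z ≤ ptEq m m' → z ≤ mem m → z ≤ mem m'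
  induct : ∀ {z : H}, z ≤ mem (Pt.pure hM (mzero M)) →
    (∀ m, ∀ z' ≤ z, z' ≤ mem m → z' ≤ mem (Pt.succ hM m)) → ∀ m, z ≤ mem m

/-- The class of the numbers that satisfy `P`. -/
def Cls.comp (hM : IsModel M) (n : ℕ) (P : HAN.Fm) (hP : P.Bounded fun _ => n + 1)
    (ρ : ℕ → Pt M) : Cls hM where
  mem m := pval hM (scons m ρ) P
  mem_congr {m m' z} h h' := by
    obtain ⟨A, hA⟩ := exists_tracks hM P hP
    refine near_elim n ρ fun σ z' hz hσ => ?_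
    -- Equal points share a representative `a`, and the tracking proposition sees only `a`.
    refine le_of_le_iSup (hz.trans h) fun a z'' hz' ha => ?_
    exact (hA z'' _ _ (le_near_scons (ha.trans inf_le_right) (hz'.trans hσ))).2
      ((hA z'' _ _ (le_near_scons (ha.trans inf_le_left) (hz'.trans hσ))).1
        ((hz'.trans hz).trans h'))
  induct {z} h0 hs m := by
    obtain ⟨A, hA⟩ := exists_tracks hM P hP
    refine near_elim n ρ fun σ z' hz hσ => m.elim fun a z'' hz' ha => ?_
    refine (hA z'' _ _ (le_near_scons ha (hz'.trans hσ))).2 (hM.induct A σ ?_ ?_ a)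
    · exact (hA z'' _ _ (le_near_scons (Pt.le_mem_pure hM _) (hz'.trans hσ))).1
        ((hz'.trans hz).trans h0)
    · intro b w hw h
      have hw' := hw.trans (hz'.trans hσ)
      -- The step from `b` in `M` is the step of the class at the point `pure hM b`, whose successor
      -- is represented by `msucc M b`.
      refine (hA w _ _ (le_near_scons (Pt.le_mem_succ hM (Pt.le_mem_pure hM b)) hw')).1 ?_
      exact hs _ w (hw.trans (hz'.trans hz))
        ((hA w _ _ (le_near_scons (Pt.le_mem_pure hM b) hw')).2 h)

open HAModulo (Srt)

/-- The carriers of the two-sorted model. -/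
abbrev sorted (hM : IsModel M) : Srt → Type
  | .num => Pt M
  | .cls => Cls hM

/-- The model of the rewrite rules on the definable numbers. -/
abbrev fullModel (hM : IsModel M) : Model HAModulo.lang H where
  carrier := sorted hM
  fn
    | .arith f => (ptModel hM).fn f
    | .comp n P hP => fun ts => Cls.comp hM n P hP fun i =>
      -- The default only fills indices beyond the parameters of `P`, so it cannot affect the class.
      if h : i < n then ts ⟨i, h⟩ else Pt.pure hM (mzero M)
  rel
    | .arith r => (ptModel hM).rel r
    | .mem => fun ts => (ts 1 : Cls hM).mem (ts 0 : Pt M)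
  ext _ _ := ⊤

theorem fullModel_termRule (hM : IsModel M) (s : Srt) (l r : Term HAModulo.lang s)
    (ρ : Env HAModulo.lang (fullModel hM).carrier) (h : HAModulo.TermRule s l r) :
    (fullModel hM).eval ρ l = (fullModel hM).eval ρ r := by
  cases h with
  | pred_zero => exact Pt.pred_zero hM
  | pred_succ => exact Pt.pred_succ hM _
  | zero_add => exact Pt.zero_add hM _
  | succ_add => exact Pt.succ_add hM _ _
  | zero_mul => exact Pt.zero_mul hM _
  | succ_mul => exact Pt.succ_mul hM _ _

theorem ptEq_eq (hM : IsModel M) (m m' : Pt M) :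
    ptEq m m' = ⨅ c : Cls hM, c.mem m ⇨ c.mem m' := by
  refine le_antisymm (le_iInf fun c => le_himp_iff.2 (c.mem_congr inf_le_left inf_le_right)) ?_
  -- The class of the numbers equal to `m`, with `m` as its parameter: it contains `m`, so a
  -- Leibniz-equal `m'` belongs to it.
  let c : Cls hM := Cls.comp hM 1 (Formula.rel (L := HAN.lang) HAN.Rel.eq
    (![HAN.var 1, HAN.var 0] : Fin 2 → HAN.Tm))
    (fun i => match i with
      | 0 => Nat.lt_succ_self 1
      | 1 => Nat.succ_pos 1) fun _ => m
  refine (iInf_le _ c).trans ?_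
  have h : (⊤ : H) ≤ c.mem m :=
    m.elim fun a z _ ha => (le_inf ha ha).trans (le_iSup (fun a => m.mem a ⊓ m.mem a) a)
  rw [top_le_iff.1 h, top_himp]
  exact le_rfl

theorem fullModel_propRule (hM : IsModel M) (l r : HAModulo.Fm)
    (ρ : Env HAModulo.lang (fullModel hM).carrier) (h : HAModulo.PropRule l r) :
    (fullModel hM).val ρ l = (fullModel hM).val ρ r := by
  cases h with
  | eq =>
    refine (ptEq_eq hM (ρ .num 1) (ρ .num 0)).trans (iInf_congr fun c => ?_)
    rw [top_himp]
    rfl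
  | nat =>
    -- `N` has value `⊤`, so the right-hand side must have value `⊤`: this is the induction built
    -- into `Cls`.
    refine Eq.symm (top_le_iff.1 (le_iInf fun c => ?_))
    rw [top_himp]
    refine le_himp_iff.2 (le_himp_iff.2 ?_)
    refine Cls.induct c (inf_le_left.trans inf_le_right) (fun m z hz h => ?_) (ρ .num 0)
    have h1 := (hz.trans inf_le_right).trans (iInf_le _ m)
    rw [top_himp] at h1
    exact le_himp_iff_forall.1 (le_himp_iff_forall.1 h1 z le_rfl le_top) z le_rfl h
  | comp n P hP =>
    rw [HAModulo.val_ofHAN]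
    refine (ptModel hM).val_congr (fun s i hi => ?_) hP
    cases i with
    | zero => rfl
    | succ i =>
      exact dif_pos (Nat.lt_of_succ_lt_succ hi)
  | null_zero => exact top_le_iff.1 (hM.refl _)
  | null_succ =>
    refine le_bot_iff.1 (Pt.elim (ρ .num 0) fun a z hz ha => ?_)
    exact hM.zero_ne_succ ((Pt.succ hM (ρ .num 0)).unique hz (Pt.le_mem_succ hM ha))

theorem termModel_isModel : IsModel theory.termModel where
  ext_eq _ _ := rfl
  axioms_val A hA ρ := by
    rw [Theory.termModel_val, (Axiom.closed hA).subst_eq, Theory.toVal_eq_top]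
    exact .ax hA rfl

/-- A closed proposition of HA is a theorem of HA if its relativization is a theorem of the
theory modulo. -/
theorem provable_of_HAModulo_provable {A : Fm} (hA : A.Closed)
    (h : HAModulo.Provable (HAModulo.ofHAN (HAN.translate A))) : Provable A := by
  have hM := termModel_isModel
  let m : Pt theory.termModel := Pt.pure hM (mzero _)
  -- Soundness needs some value for the class variables; any class would do.
  let c : Cls hM := Cls.comp hM 0 .top trivial fun _ => m
  let ρ : Env HAModulo.lang (fullModel hM).carrier := fun s _ => match s with
    | .num => m
    | .cls => c
  have h1 : (⊤ : theory.Val) ≤ (fullModel hM).val ρ _ :=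
    Model.le_val_of_proves (fun _ _ _ _ => le_top)
      (fun _ _ ρ h => h.val_eq (fullModel_termRule hM) (fullModel_propRule hM) ρ) h
      (fun _ _ => le_top) (fun _ hC => hC.elim)
  rw [HAModulo.val_ofHAN] at h1
  have h2 := h1.trans (HAN.val_translate (ptModel hM) (fun _ _ => rfl) _ A).le
  -- With no parameters `near` is `⊤`, and the environment of variables is the identity
  -- substitution, so the value obtained is that of `A` itself.
  have h3 := (tracks_self hM A hA ⊤ _ (fun n => var n) le_top).1 h2
  rw [sval, Theory.termModel_val, hA.subst_eq] at h3
  exact Theory.toVal_eq_top.1 (top_le_iff.1 h3)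

end HA

end DedMod

theorem mainTheorem1 (A : DedMod.HA.Fm) (hA : A.Closed) :
    DedMod.HAModulo.Provable (DedMod.HAModulo.ofHAN (DedMod.HAN.translate A)) ↔
      DedMod.HA.Provable A :=
  ⟨DedMod.HA.provable_of_HAModulo_provable hA, DedMod.HAModulo.provable_of_HA_provable hA⟩
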